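/- Let $\mathbb{K}$ be a field and let $G$ be a finite simple graph with nonempty vertex set $V(G)=\{x_1,\dots,x_n\}$; put $S=\mathbb{K}[x_1,\dots,x_n]$. Assume that $G$ is claw-free, that is, $G$ has no induced subgraph isomorphic to $K_{1,3}$. Let $$J(G)=\Big(\prod_{x_i\in C}x_i \;\Big|\; C \text{ is a minimal vertex cover of } G\Big)\subseteq S$$ be the cover ideal of $G$, let ${\rm deg}(J(G))$ be the maximum degree of its minimal monomial generators, and for an integer $k\ge 1$ let $$J(G)^{(k)}=\bigcap_{\mathfrak p\in {\rm Min}(J(G))}{\rm Ker}\big(S\to (S/J(G)^k)_{\mathfrak p}\big)$$ be the $k$-th symbolic power of $J(G)$, where ${\rm Min}(J(G))$ is the set of minimal primes of $J(G)$ (so $J(G)^{(k)}=S$ if $G$ has no edges). For a nonzero homogeneous ideal $I$ of $S$ let ${\rm reg}(I)=\max\{j-i\mid \beta_{i,j}(I)\ne 0\}$, where $\beta_{i,j}(I)$ is the number of summands $S(-j)$ in homological degree $i$ of the minimal graded free resolution of $I$ over $S$. Then for every integer $k\ge 1$, $$k\,{\rm deg}(J(G))\;\le\; {\rm reg}(J(G)^{(k)})\;\le\;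 (k-1)\,{\rm deg}(J(G))+|V(G)|-1.$$ -/

import Mathlib

namespace CoverIdealReg

/-- A graph is claw-free if the claw `K_{1,3}` is not an induced subgraph of it. -/
def ClawFree {V : Type*} (G : SimpleGraph V) : Prop :=
  ¬ (completeBipartiteGraph (Fin 1) (Fin 3)).IsIndContained G

/-- The cover ideal `J(G)` in the polynomial ring over `K` whose variables are the vertices of `G`:
it is generated by the products of the variables in `C`, for `C` a minimal vertex cover. -/
noncomputable def coverIdeal {V : Type*} (K : Type*) [Field K] (G : SimpleGraph V) :
    Ideal (MvPolynomial V K) :=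
  Ideal.span {f | ∃ C : Finset V, Minimal G.IsVertexCover (C : Set V) ∧
    f = ∏ x ∈ C, MvPolynomial.X x}

/-- The `k`-th symbolic power of an ideal `I` of `R`: the intersection, over the minimal primes `p`
of `I`, of the kernels of the canonical maps from `R` to the localization of `R / I ^ k` at `p`. -/
noncomputable def symbolicPower {R : Type*} [CommRing R] (I : Ideal R) (k : ℕ) : Ideal R :=
  ⨅ p : I.minimalPrimes,
    haveI : (p : Ideal R).IsPrime := p.2.1.1
    LinearMap.ker
      ((LocalizedModule.mkLinearMap (p : Ideal R).primeCompl (R ⧸ I ^ k)).comp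
        (Submodule.mkQ (I ^ k)))

/-- The (exponents of the) minimal monomial generators of a monomial ideal `I`: the monomials of `I`
that are minimal with respect to divisibility. -/
def minimalMonomials {σ K : Type*} [Field K] (I : Ideal (MvPolynomial σ K)) : Set (σ →₀ ℕ) :=
  {a | Minimal (fun b : σ →₀ ℕ => MvPolynomial.monomial b (1 : K) ∈ I) a}

/-- The degree of a nonzero monomial ideal in finitely many variables: the largest degree of a
minimal monomial generator (the set of these is then finite and nonempty). -/
noncomputable def monomialDegree {σ K : Type*} [Field K] (I : Ideal (MvPolynomial σ K)) : ℕ :=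
  sSup ((fun a : σ →₀ ℕ => a.degree) '' minimalMonomials I)

/-- `f` is homogeneous of degree `j` in the graded free module `⨁ a, S(-s a)`, where `S` is the
polynomial ring with its standard grading: the basis vector with index `a` has degree `s a`. -/
def IsHomogeneousVec {σ K : Type*} [Field K] {r : ℕ} (s : Fin r → ℤ)
    (f : Fin r → MvPolynomial σ K) (j : ℤ) : Prop :=
  ∀ a, ∀ m ∈ (f a).support, (m.degree : ℤ) + s a = j

/-- A minimal graded free resolution
`⋯ → F 2 → F 1 → F 0 → I → 0` of an ideal `I` of the polynomial ring `S`, where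
`F i = ⨁ b : Fin (rank i), S(-shift i b)` is free of finite rank, and the maps are homogeneous of
degree `0`. -/
structure MinimalResolution {σ K : Type*} [Field K] (I : Ideal (MvPolynomial σ K)) where
  /-- the rank of the `i`-th free module -/
  rank : ℕ → ℕ
  /-- the degrees of its basis vectors -/
  shift : ∀ i, Fin (rank i) → ℤ
  /-- the differential from the module with index `i + 1` to the one with index `i` -/
  d : ∀ i, (Fin (rank (i + 1)) → MvPolynomial σ K) →ₗ[MvPolynomial σ K]
    (Fin (rank i) → MvPolynomial σ K)
  /-- the augmentation -/
  aug : (Fin (rank 0) → MvPolynomial σ K) →ₗ[MvPolynomial σ K] MvPolynomial σ K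
  d_homogeneous : ∀ i b, IsHomogeneousVec (shift i) (d i (Pi.single b 1)) (shift (i + 1) b)
  aug_homogeneous : ∀ b, ∀ m ∈ (aug (Pi.single b 1)).support, (m.degree : ℤ) = shift 0 b
  range_aug : LinearMap.range aug = I
  exact_zero : LinearMap.range (d 0) = LinearMap.ker aug
  exact_succ : ∀ i, LinearMap.range (d (i + 1)) = LinearMap.ker (d i)
  /-- minimality: the image of each differential lies in `𝔪 F`, with `𝔪` the ideal generated by
  the variables, that is, of the polynomials without constant term -/
  minimal : ∀ i b a, MvPolynomial.constantCoeff (d i (Pi.single b 1) a) = 0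

/-- The graded Betti number `β_{i,j}`: the number of summands `S(-j)` in homological degree `i`. -/
def MinimalResolution.betti {σ K : Type*} [Field K] {I : Ideal (MvPolynomial σ K)}
    (F : MinimalResolution I) (i : ℕ) (j : ℤ) : ℕ :=
  (Finset.univ.filter fun b => F.shift i b = j).card

/-- `I` has Castelnuovo-Mumford regularity `r`: there is a minimal graded free resolution of `I`,
and `r = max {j - i | β_{i,j}(I) ≠ 0}`, whichever minimal resolution is used to compute the
graded Betti numbers. In particular `r` is unique. -/
def HasRegularity {σ K : Type*} [Field K] (I : Ideal (MvPolynomial σ K)) (r : ℤ) : Prop :=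
  Nonempty (MinimalResolution I) ∧
    ∀ F : MinimalResolution I,
      IsGreatest {t : ℤ | ∃ (i : ℕ) (j : ℤ), F.betti i j ≠ 0 ∧ t = j - i} r

end CoverIdealReg

-- The minimal primes of the cover ideal are the ideals `(x_i, x_j)` for edges `ij`, so `J^(k)` is
-- the monomial ideal of the exponents `m` with `m i + m j ≥ k` on every edge
-- (`symbolicPower_coverIdeal`). For a minimal vertex cover `C` of largest size, the `k`-th power of
-- its monomial is a minimal generator of `J^(k)`, and the degree of a minimal generator never
-- exceeds the regularity. This is the lower bound.
--
-- For the upper bound, impose also `m ≥ w` and split at a vertex `v`: either the exponent of `v` is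
-- raised above `w v`, or `v` is frozen, every neighbor is raised to at least `k - w v`, and the
-- edges at `v` drop out. If `A` and `B` are the two resulting ideals, their sum is the original one
-- and `A ∩ B = x_v B`, so the sequence `0 → B(-1) → A ⊕ B → A + B → 0` gives `reg (A + B) ≤ max
-- (reg A) (reg B)` (`regLE_coverSet_step`). When no edge condition is left, the ideal is principal,
-- generated in degree `∑ w`. Hence it suffices to bound `∑ w` at the leaves of a suitable splitting
-- tree.
--
-- The splitting is organized in rounds. In a round all vertices of `W` have exponent `l`, and each
-- is frozen, raised to `l + 1`, or already has a frozen neighbor. If `Z` is frozen, `N` is its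
-- neighborhood in `W`, and `H` is the rest, then `∑ w` grows by `(k - 2l)|N| + |H|`, and the next
-- round plays on the non-isolated part `H'` of `H` at level `l + 1`. Let `c` bound the sizes of the
-- minimal vertex covers on `W`, and let `A` be a smallest independent dominating set of `H'`.
-- Completing `A` to an independent dominating set of `W` gives `|N| + (|H'| - |A|) ≤ c`, so `c' =
-- |H'| - |A|` is an admissible bound on `H'`. The quantity `∑ w + (k - 2l - 1) c + |W|` then does
-- not increase provided `|H'| ≤ 2 c'`, that is, `2|A| ≤ |H'|`. Claw-freeness enters only here: any
-- dominating set can be made independent without growing (`ClawFree.exists_independent_dominates`),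
-- and without isolated vertices either a maximal independent set or its complement has at most half
-- of the vertices.
--
-- Regularity is handled through truncated graded resolutions with shifts at most `r + i` in
-- homological degree `i` (`HasRes`). These are stable under extensions and mapping cones, and they
-- bound the shifts of every minimal resolution (`MinimalResolution.shift_le`).

universe u v

namespace CoverIdealReg

/-! ### Graded free covers and truncated resolutions with bounded shifts. -/

section Grading

variable {σ : Type u} {K : Type v} [Field K]

/-- The homogeneous vectors of degree `j` in the free module with basis degrees `s`. -/
def vecGrading {κ : Type} (s : κ → ℤ) (j : ℤ) : AddSubgroup (κ → MvPolynomial σ K) where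
  carrier := {f | ∀ a, ∀ m ∈ (f a).support, (m.degree : ℤ) + s a = j}
  zero_mem' := by intro a m hm; simp at hm
  add_mem' := by
    classical
    intro f g hf hg a m hm
    rcases Finset.mem_union.1 (MvPolynomial.support_add hm) with h | h
    · exact hf a m h
    · exact hg a m h
  neg_mem' := by
    intro f hf a m hm
    exact hf a m (by simpa using hm)

theorem mem_vecGrading {κ : Type} {s : κ → ℤ} {j : ℤ} {f : κ → MvPolynomial σ K} :
    f ∈ vecGrading s j ↔ ∀ a, ∀ m ∈ (f a).support, (m.degree : ℤ) + s a = j := Iff.rfl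

/-- A family of subgroups is compatible with the grading of the polynomial ring. -/
def IsGrading {M : Type (max u v)} [AddCommGroup M] [Module (MvPolynomial σ K) M]
    (ℳ : ℤ → AddSubgroup M) : Prop :=
  ∀ (p : MvPolynomial σ K) (d : ℤ) (x : M) (j : ℤ),
    (∀ m ∈ p.support, (m.degree : ℤ) = d) → x ∈ ℳ j → p • x ∈ ℳ (d + j)

theorem isGrading_vecGrading {κ : Type} (s : κ → ℤ) :
    IsGrading (σ := σ) (K := K) (vecGrading (σ := σ) (K := K) s) := by
  classical
  intro p d x j hp hx a m hm
  rw [Pi.smul_apply, smul_eq_mul] at hm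
  obtain ⟨m1, h1, m2, h2, rfl⟩ := Finset.mem_add.1 (MvPolynomial.support_mul _ _ hm)
  have e1 := hp m1 h1
  have e2 := hx a m2 h2
  rw [map_add]
  push_cast
  omega

/-- The grading of the kernel of a map out of a graded free module. -/
noncomputable def kerGrading {κ : Type} (s : κ → ℤ) {M : Type (max u v)} [AddCommGroup M]
    [Module (MvPolynomial σ K) M] (φ : (κ → MvPolynomial σ K) →ₗ[MvPolynomial σ K] M) (j : ℤ) :
    AddSubgroup (LinearMap.ker φ) :=
  (vecGrading s j).comap (LinearMap.ker φ).subtype.toAddMonoidHom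

theorem mem_kerGrading {κ : Type} {s : κ → ℤ} {M : Type (max u v)} [AddCommGroup M]
    [Module (MvPolynomial σ K) M] {φ : (κ → MvPolynomial σ K) →ₗ[MvPolynomial σ K] M} {j : ℤ}
    {x : LinearMap.ker φ} : x ∈ kerGrading s φ j ↔ (x : κ → MvPolynomial σ K) ∈ vecGrading s j :=
  Iff.rfl

theorem isGrading_kerGrading {κ : Type} (s : κ → ℤ) {M : Type (max u v)} [AddCommGroup M]
    [Module (MvPolynomial σ K) M] (φ : (κ → MvPolynomial σ K) →ₗ[MvPolynomial σ K] M) :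
    IsGrading (σ := σ) (K := K) (kerGrading s φ) := by
  intro p d x j hp hx
  exact isGrading_vecGrading s p d x j hp hx

/-- `φ` is a surjection of graded modules from the graded free module with basis degrees `s`. -/
structure IsCover {κ : Type} (s : κ → ℤ) {M : Type (max u v)} [AddCommGroup M]
    [Module (MvPolynomial σ K) M] (ℳ : ℤ → AddSubgroup M)
    (φ : (κ → MvPolynomial σ K) →ₗ[MvPolynomial σ K] M) : Prop where
  map_mem : ∀ j, ∀ x ∈ vecGrading s j, φ x ∈ ℳ j
  surj : Function.Surjective φ
  exists_lift : ∀ j, ∀ y ∈ ℳ j, ∃ x ∈ vecGrading s j, φ x = y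

theorem single_mem_vecGrading {κ : Type} [DecidableEq κ] (s : κ → ℤ) (a : κ) :
    (Pi.single a 1 : κ → MvPolynomial σ K) ∈ vecGrading s (s a) := by
  classical
  intro b m hm
  rcases eq_or_ne b a with rfl | h
  · rw [Pi.single_eq_same, MvPolynomial.mem_support_iff, MvPolynomial.coeff_one] at hm
    have : m = 0 := by by_contra h; exact hm (if_neg (Ne.symm h))
    simp [this]
  · rw [Pi.single_eq_of_ne h] at hm
    simp at hm

theorem map_mem_of_single {κ : Type} [Fintype κ] [DecidableEq κ] {s : κ → ℤ}
    {M : Type (max u v)} [AddCommGroup M] [Module (MvPolynomial σ K) M]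
    {ℳ : ℤ → AddSubgroup M} (hℳ : IsGrading (σ := σ) (K := K) ℳ)
    {φ : (κ → MvPolynomial σ K) →ₗ[MvPolynomial σ K] M}
    (h : ∀ a, φ (Pi.single a 1) ∈ ℳ (s a)) (j : ℤ) (x : κ → MvPolynomial σ K)
    (hx : x ∈ vecGrading s j) : φ x ∈ ℳ j := by
  have e : x = ∑ a, x a • (Pi.single a 1 : κ → MvPolynomial σ K) := by
    simpa using (pi_eq_sum_univ' x)
  rw [e, map_sum]
  refine AddSubgroup.sum_mem _ fun a _ => ?_
  rw [map_smul]
  have := hℳ (x a) (j - s a) _ _ (fun m hm => by have := hx a m hm; omega) (h a)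
  simpa using this

/-- A graded map from a graded free module lifts along a graded surjection. -/
theorem exists_graded_lift {κ κ' : Type} [Fintype κ] {s : κ → ℤ} {s' : κ' → ℤ}
    {M : Type (max u v)} [AddCommGroup M] [Module (MvPolynomial σ K) M]
    {ℳ : ℤ → AddSubgroup M}
    {φ : (κ → MvPolynomial σ K) →ₗ[MvPolynomial σ K] M}
    {ψ : (κ' → MvPolynomial σ K) →ₗ[MvPolynomial σ K] M}
    (hφ : ∀ j, ∀ x ∈ vecGrading s j, φ x ∈ ℳ j) (hψ : IsCover s' ℳ ψ) :
    ∃ α : (κ → MvPolynomial σ K) →ₗ[MvPolynomial σ K] (κ' → MvPolynomial σ K),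
      (∀ x, ψ (α x) = φ x) ∧ ∀ j, ∀ x ∈ vecGrading s j, α x ∈ vecGrading s' j := by
  classical
  have h : ∀ a, ∃ y ∈ vecGrading s' (s a), ψ y = φ (Pi.single a 1) := fun a =>
    hψ.exists_lift _ _ (hφ _ _ (single_mem_vecGrading s a))
  choose y hy hyφ using h
  let α := (Pi.basisFun (MvPolynomial σ K) κ).constr (MvPolynomial σ K) y
  have hα : ∀ a, α (Pi.single a 1) = y a := fun a => by
    rw [← Pi.basisFun_apply]; exact Module.Basis.constr_basis _ _ _ _
  refine ⟨α, fun x => ?_, map_mem_of_single (isGrading_vecGrading s') fun a => by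
    rw [hα]; exact hy a⟩
  have : ψ ∘ₗ α = φ := by
    refine (Pi.basisFun (MvPolynomial σ K) κ).ext fun a => ?_
    rw [Pi.basisFun_apply, LinearMap.comp_apply, hα, hyφ]
  rw [← this]; rfl

/-- `M` has the first `n` steps of a graded free resolution of finite rank, in which the basis
vectors in homological degree `i` have degree at most `r + i`. -/
def HasRes : ℕ → ∀ (M : Type (max u v)) [AddCommGroup M] [Module (MvPolynomial σ K) M]
    (_ : ℤ → AddSubgroup M) (_ : ℤ), Prop
  | 0, _, _, _, _, _ => True
  | n + 1, M, _, _, ℳ, r =>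
    ∃ (κ : Type) (_ : Fintype κ) (s : κ → ℤ)
      (φ : (κ → MvPolynomial σ K) →ₗ[MvPolynomial σ K] M),
      (∀ a, s a ≤ r) ∧ IsCover s ℳ φ ∧ HasRes n (LinearMap.ker φ) (kerGrading s φ) (r + 1)

/-- The constant `c` allows a twist of the grading; the case `c = 1` serves for `B(-1)` and `c = 0`
for replacing a kernel by an equal one. -/
theorem HasRes.equiv (n : ℕ) : ∀ {M N : Type (max u v)} [AddCommGroup M] [AddCommGroup N]
    [Module (MvPolynomial σ K) M] [Module (MvPolynomial σ K) N] {ℳ : ℤ → AddSubgroup M}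
    {𝒩 : ℤ → AddSubgroup N} {r c : ℤ} (e : M ≃ₗ[MvPolynomial σ K] N)
    (_ : ∀ j x, x ∈ ℳ j ↔ e x ∈ 𝒩 (j + c)),
    HasRes (σ := σ) (K := K) n M ℳ r → HasRes (σ := σ) (K := K) n N 𝒩 (r + c) := by
  induction n with
  | zero => intros; trivial
  | succ n ih =>
    intro M N _ _ _ _ ℳ 𝒩 r c e he ⟨κ, hκ, s, φ, hs, hφ, hr⟩
    have hv : ∀ j (x : κ → MvPolynomial σ K),
        x ∈ vecGrading s j ↔ x ∈ vecGrading (fun a => s a + c) (j + c) := by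
      intro j x
      refine forall_congr' fun a => forall_congr' fun m => forall_congr' fun _ => ?_
      show _ + s a = j ↔ _ + (s a + c) = j + c
      constructor <;> intro h <;> omega
    refine ⟨κ, hκ, fun a => s a + c, e.toLinearMap ∘ₗ φ, fun a => by
      have := hs a; show s a + c ≤ r + c; omega, ⟨?_, ?_, ?_⟩, ?_⟩
    · intro j x hx
      have : x ∈ vecGrading s (j - c) := by rw [hv]; simpa using hx
      have := (he _ _).1 (hφ.map_mem _ _ this)
      simpa using this
    · exact e.surjective.comp hφ.surj
    · intro j y hy
      obtain ⟨x, hx, hxy⟩ := hφ.exists_lift (j - c) (e.symm y) (by rw [he]; simpa using hy)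
      refine ⟨x, by rw [hv] at hx; simpa using hx, by simp [hxy]⟩
    · have hk : LinearMap.ker φ = LinearMap.ker (e.toLinearMap ∘ₗ φ) := by
        ext x; simp
      have := ih (c := c) (𝒩 := kerGrading (fun a => s a + c) (e.toLinearMap ∘ₗ φ))
        (LinearEquiv.ofEq _ _ hk) (fun j x => ?_) hr
      · convert this using 1; ring
      · rw [mem_kerGrading, mem_kerGrading, hv]; rfl

theorem HasRes.mono {n : ℕ} : ∀ {M : Type (max u v)} [AddCommGroup M]
    [Module (MvPolynomial σ K) M] {ℳ : ℤ → AddSubgroup M} {r r' : ℤ} (_ : r ≤ r'),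
    HasRes (σ := σ) (K := K) n M ℳ r → HasRes (σ := σ) (K := K) n M ℳ r' := by
  induction n with
  | zero => intros; trivial
  | succ n ih =>
    intro M _ _ ℳ r r' h ⟨κ, hκ, s, φ, hs, hφ, hr⟩
    exact ⟨κ, hκ, s, φ, fun a => (hs a).trans h, hφ, ih (by omega) hr⟩

theorem HasRes.of_subsingleton (n : ℕ) : ∀ {M : Type (max u v)} [AddCommGroup M]
    [Module (MvPolynomial σ K) M] [Subsingleton M] (ℳ : ℤ → AddSubgroup M) (r : ℤ),
    HasRes (σ := σ) (K := K) n M ℳ r := by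
  induction n with
  | zero => intros; trivial
  | succ n ih =>
    intro M _ _ _ ℳ r
    refine ⟨Empty, inferInstance, Empty.elim, 0, fun a => a.elim, ⟨?_, ?_, ?_⟩, ih _ _⟩
    · intro j x _; rw [LinearMap.zero_apply]; exact zero_mem _
    · intro y; exact ⟨0, Subsingleton.elim _ _⟩
    · intro j y _; exact ⟨0, zero_mem _, Subsingleton.elim _ _⟩

theorem HasRes.of_free (n : ℕ) {κ : Type} [Fintype κ] {s : κ → ℤ} {r : ℤ} (hs : ∀ a, s a ≤ r) :
    HasRes (σ := σ) (K := K) n (κ → MvPolynomial σ K) (vecGrading s) r := by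
  cases n with
  | zero => trivial
  | succ n =>
    refine ⟨κ, inferInstance, s, LinearMap.id, hs, ⟨fun j x h => h, fun x => ⟨x, rfl⟩,
      fun j y hy => ⟨y, hy, rfl⟩⟩, ?_⟩
    have : Subsingleton (LinearMap.ker
        (LinearMap.id : (κ → MvPolynomial σ K) →ₗ[MvPolynomial σ K] _)) := by
      rw [LinearMap.ker_id]; infer_instance
    exact HasRes.of_subsingleton _ _ _

/-- A short exact sequence of graded modules. -/
structure IsGradedExact {A B C : Type (max u v)} [AddCommGroup A] [AddCommGroup B]
    [AddCommGroup C] [Module (MvPolynomial σ K) A] [Module (MvPolynomial σ K) B]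
    [Module (MvPolynomial σ K) C] (𝒜 : ℤ → AddSubgroup A) (ℬ : ℤ → AddSubgroup B)
    (𝒞 : ℤ → AddSubgroup C) (f : A →ₗ[MvPolynomial σ K] B) (g : B →ₗ[MvPolynomial σ K] C) :
    Prop where
  isGrading : IsGrading (σ := σ) (K := K) ℬ
  inj : Function.Injective f
  exact : ∀ b, g b = 0 ↔ ∃ a, f a = b
  surj : Function.Surjective g
  mem_iff : ∀ j a, a ∈ 𝒜 j ↔ f a ∈ ℬ j
  map_mem : ∀ j, ∀ b ∈ ℬ j, g b ∈ 𝒞 j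
  exists_lift : ∀ j, ∀ c ∈ 𝒞 j, ∃ b ∈ ℬ j, g b = c

theorem sumElim_mem_vecGrading {κ κ' : Type} {s : κ → ℤ} {s' : κ' → ℤ} {j : ℤ}
    {x : κ ⊕ κ' → MvPolynomial σ K} :
    x ∈ vecGrading (Sum.elim s s') j ↔
      x ∘ Sum.inl ∈ vecGrading s j ∧ x ∘ Sum.inr ∈ vecGrading s' j := by
  simp only [mem_vecGrading, Sum.forall, Sum.elim_inl, Sum.elim_inr, Function.comp]

/-- The horseshoe lemma. -/
theorem HasRes.horseshoe (n : ℕ) : ∀ {A B C : Type (max u v)} [AddCommGroup A] [AddCommGroup B]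
    [AddCommGroup C] [Module (MvPolynomial σ K) A] [Module (MvPolynomial σ K) B]
    [Module (MvPolynomial σ K) C] {𝒜 : ℤ → AddSubgroup A} {ℬ : ℤ → AddSubgroup B}
    {𝒞 : ℤ → AddSubgroup C} {f : A →ₗ[MvPolynomial σ K] B} {g : B →ₗ[MvPolynomial σ K] C}
    {r : ℤ} (_ : IsGradedExact 𝒜 ℬ 𝒞 f g), HasRes (σ := σ) (K := K) n A 𝒜 r →
    HasRes (σ := σ) (K := K) n C 𝒞 r → HasRes (σ := σ) (K := K) n B ℬ r := by
  induction n with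
  | zero => intros; trivial
  | succ n ih =>
    intro A B C _ _ _ _ _ _ 𝒜 ℬ 𝒞 f g r h ⟨κ, hκ, s, φ, hs, hφ, hr⟩ ⟨κ', hκ', s', φ', hs', hφ', hr'⟩
    classical
    -- Since its source is free, the cover of `C` lifts to a graded map `ψ` into `B`; together with
    -- `f ∘ φ` it covers `B`.
    have hl : ∀ a, ∃ y ∈ ℬ (s' a), g y = φ' (Pi.single a 1) := fun a =>
      h.exists_lift _ _ (hφ'.map_mem _ _ (single_mem_vecGrading s' a))
    choose y hy hyφ using hl
    let ψ := (Pi.basisFun (MvPolynomial σ K) κ').constr (MvPolynomial σ K) y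
    have hψ : ∀ a, ψ (Pi.single a 1) = y a := fun a => by
      rw [← Pi.basisFun_apply]; exact Module.Basis.constr_basis _ _ _ _
    have hψm : ∀ j, ∀ x ∈ vecGrading s' j, ψ x ∈ ℬ j :=
      map_mem_of_single h.isGrading fun a => by rw [hψ]; exact hy a
    have hgψ : ∀ x, g (ψ x) = φ' x := by
      intro x
      have : g ∘ₗ ψ = φ' := by
        refine (Pi.basisFun (MvPolynomial σ K) κ').ext fun a => ?_
        rw [Pi.basisFun_apply, LinearMap.comp_apply, hψ, hyφ]
      rw [← this]; rfl
    have hgf : ∀ a, g (f a) = 0 := fun a => (h.exact _).2 ⟨a, rfl⟩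
    let L := LinearMap.funLeft (MvPolynomial σ K) (MvPolynomial σ K) (Sum.inl : κ → κ ⊕ κ')
    let R := LinearMap.funLeft (MvPolynomial σ K) (MvPolynomial σ K) (Sum.inr : κ' → κ ⊕ κ')
    let Φ : (κ ⊕ κ' → MvPolynomial σ K) →ₗ[MvPolynomial σ K] B := f ∘ₗ φ ∘ₗ L + ψ ∘ₗ R
    have hΦ : ∀ x, Φ x = f (φ (x ∘ Sum.inl)) + ψ (x ∘ Sum.inr) := fun x => rfl
    have hgΦ : ∀ x, g (Φ x) = φ' (x ∘ Sum.inr) := fun x => by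
      rw [hΦ, map_add, hgf, hgψ, zero_add]
    refine ⟨κ ⊕ κ', inferInstance, Sum.elim s s', Φ, ?_, ⟨?_, ?_, ?_⟩, ?_⟩
    · rintro (a | a)
      · exact hs a
      · exact hs' a
    · intro j x hx
      rw [sumElim_mem_vecGrading] at hx
      rw [hΦ]
      exact add_mem ((h.mem_iff _ _).1 (hφ.map_mem _ _ hx.1)) (hψm _ _ hx.2)
    · intro b
      obtain ⟨x', hx'⟩ := hφ'.surj (g b)
      obtain ⟨a, ha⟩ := (h.exact (b - ψ x')).1 (by rw [map_sub, hgψ, hx', sub_self])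
      obtain ⟨x, rfl⟩ := hφ.surj a
      refine ⟨Sum.elim x x', ?_⟩
      rw [hΦ, Sum.elim_comp_inl, Sum.elim_comp_inr, ha, sub_add_cancel]
    · intro j b hb
      obtain ⟨x', hxm', hx'⟩ := hφ'.exists_lift j (g b) (h.map_mem _ _ hb)
      obtain ⟨a, ha⟩ := (h.exact (b - ψ x')).1 (by rw [map_sub, hgψ, hx', sub_self])
      obtain ⟨x, hxm, rfl⟩ := hφ.exists_lift j a
        (by rw [h.mem_iff, ha]; exact sub_mem hb (hψm _ _ hxm'))
      refine ⟨Sum.elim x x', sumElim_mem_vecGrading.2 ⟨hxm, hxm'⟩, ?_⟩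
      rw [hΦ, Sum.elim_comp_inl, Sum.elim_comp_inr, ha, sub_add_cancel]
    -- The kernels form a graded short exact sequence `ker φ → ker Φ → ker φ'`, to which the
    -- induction hypothesis applies.
    · let E : (κ → MvPolynomial σ K) →ₗ[MvPolynomial σ K] (κ ⊕ κ' → MvPolynomial σ K) :=
        (LinearEquiv.sumArrowLequivProdArrow κ κ' (MvPolynomial σ K)
          (MvPolynomial σ K)).symm.toLinearMap ∘ₗ LinearMap.inl _ _ _
      have hEl : ∀ x, E x ∘ Sum.inl = x := fun x => rfl
      have hEr : ∀ x, E x ∘ Sum.inr = 0 := fun x => rfl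
      have hEk : ∀ x ∈ LinearMap.ker φ, E x ∈ LinearMap.ker Φ := fun x hx => by
        rw [LinearMap.mem_ker, hΦ, hEl, hEr, LinearMap.mem_ker.1 hx, map_zero, map_zero, add_zero]
      have hRk : ∀ x ∈ LinearMap.ker Φ, R x ∈ LinearMap.ker φ' := fun x hx => by
        rw [LinearMap.mem_ker]
        exact (hgΦ x).symm.trans (by rw [LinearMap.mem_ker.1 hx, map_zero])
      refine ih (f := E.restrict hEk) (g := R.restrict hRk)
        ⟨isGrading_kerGrading _ _, ?_, ?_, ?_, ?_, ?_, ?_⟩ hr hr'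
      · intro x y hxy
        have := congrArg (fun z : LinearMap.ker Φ => (z : κ ⊕ κ' → MvPolynomial σ K) ∘ Sum.inl) hxy
        exact Subtype.ext this
      · intro x
        constructor
        · intro hx
          have hx0 : (x : κ ⊕ κ' → MvPolynomial σ K) ∘ Sum.inr = 0 := congrArg Subtype.val hx
          have hxk := LinearMap.mem_ker.1 x.2
          rw [hΦ, hx0, map_zero, add_zero] at hxk
          refine ⟨⟨(x : κ ⊕ κ' → MvPolynomial σ K) ∘ Sum.inl,
            h.inj (by rw [hxk, map_zero])⟩, Subtype.ext ?_⟩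
          funext a
          rcases a with a | a
          · rfl
          · exact (congrFun hx0 a).symm
        · rintro ⟨z, rfl⟩
          exact Subtype.ext rfl
      · intro x'
        have hx' := LinearMap.mem_ker.1 x'.2
        obtain ⟨a, ha⟩ := (h.exact (ψ x')).1 (by rw [hgψ, hx'])
        obtain ⟨x, rfl⟩ := hφ.surj a
        refine ⟨⟨Sum.elim (-x) x', ?_⟩, Subtype.ext ?_⟩
        · rw [LinearMap.mem_ker, hΦ, Sum.elim_comp_inl, Sum.elim_comp_inr, map_neg, map_neg, ha,
            neg_add_cancel]
        · rfl
      · intro j x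
        rw [mem_kerGrading, mem_kerGrading]
        refine Iff.trans ?_ sumElim_mem_vecGrading.symm
        exact (and_iff_left (zero_mem (vecGrading s' j))).symm
      · intro j x hx
        exact (sumElim_mem_vecGrading.1 hx).2
      · intro j x' hxm'
        have hx' := LinearMap.mem_ker.1 x'.2
        obtain ⟨a, ha⟩ := (h.exact (ψ x')).1 (by rw [hgψ, hx'])
        obtain ⟨x, hxm, rfl⟩ := hφ.exists_lift j a
          (by rw [h.mem_iff, ha]; exact hψm _ _ hxm')
        refine ⟨⟨Sum.elim (-x) x', ?_⟩, ?_, Subtype.ext ?_⟩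
        · rw [LinearMap.mem_ker, hΦ, Sum.elim_comp_inl, Sum.elim_comp_inr, map_neg, map_neg, ha,
            neg_add_cancel]
        · exact sumElim_mem_vecGrading.2 ⟨neg_mem hxm, hxm'⟩
        · rfl

/-- The mapping cone construction. -/
theorem HasRes.cone (n : ℕ) {A B C : Type (max u v)} [AddCommGroup A] [AddCommGroup B]
    [AddCommGroup C] [Module (MvPolynomial σ K) A] [Module (MvPolynomial σ K) B]
    [Module (MvPolynomial σ K) C] {𝒜 : ℤ → AddSubgroup A} {ℬ : ℤ → AddSubgroup B}
    {𝒞 : ℤ → AddSubgroup C} {f : A →ₗ[MvPolynomial σ K] B} {g : B →ₗ[MvPolynomial σ K] C}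
    {r : ℤ} (h : IsGradedExact 𝒜 ℬ 𝒞 f g) (hA : HasRes (σ := σ) (K := K) n A 𝒜 (r + 1))
    (hB : HasRes (σ := σ) (K := K) (n + 1) B ℬ r) :
    HasRes (σ := σ) (K := K) (n + 1) C 𝒞 r := by
  obtain ⟨κ, hκ, s, φ, hs, hφ, hr⟩ := hB
  refine ⟨κ, hκ, s, g ∘ₗ φ, hs, ⟨?_, ?_, ?_⟩, ?_⟩
  · intro j x hx
    exact h.map_mem _ _ (hφ.map_mem _ _ hx)
  · exact h.surj.comp hφ.surj
  · intro j c hc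
    obtain ⟨b, hb, rfl⟩ := h.exists_lift j c hc
    obtain ⟨x, hx, rfl⟩ := hφ.exists_lift j b hb
    exact ⟨x, hx, rfl⟩
  -- On `ker (g ∘ φ)` the map `φ` takes values in the image of `f`, hence in `A`, and its kernel is
  -- `ker φ`. Thus the first syzygies of `C` are an extension of `A` by those of `B`, and the
  -- horseshoe lemma applies with the bound `r + 1`.
  · let e := LinearEquiv.ofInjective f h.inj
    have hmem : ∀ x ∈ LinearMap.ker (g ∘ₗ φ), φ x ∈ LinearMap.range f := fun x hx =>
      (h.exact _).1 hx
    let q : LinearMap.ker (g ∘ₗ φ) →ₗ[MvPolynomial σ K] A :=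
      e.symm.toLinearMap ∘ₗ φ.restrict hmem
    have hq : ∀ x, f (q x) = φ x := fun x =>
      congrArg Subtype.val (e.apply_symm_apply (φ.restrict hmem x))
    have hle : LinearMap.ker φ ≤ LinearMap.ker (g ∘ₗ φ) := fun x hx => by
      rw [LinearMap.mem_ker, LinearMap.comp_apply, LinearMap.mem_ker.1 hx, map_zero]
    refine HasRes.horseshoe n (f := Submodule.inclusion hle) (g := q)
      ⟨isGrading_kerGrading _ _, Submodule.inclusion_injective hle, ?_, ?_, ?_, ?_, ?_⟩ hr hA
    · intro x
      constructor
      · intro hx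
        exact ⟨⟨x, by rw [LinearMap.mem_ker, ← hq, hx, map_zero]⟩, rfl⟩
      · rintro ⟨y, rfl⟩
        refine h.inj ?_
        rw [hq, map_zero]
        exact y.2
    · intro a
      obtain ⟨x, hx⟩ := hφ.surj (f a)
      refine ⟨⟨x, by rw [LinearMap.mem_ker, LinearMap.comp_apply, hx, h.exact]; exact ⟨a, rfl⟩⟩,
        h.inj ?_⟩
      rw [hq]; exact hx
    · intro j x; rfl
    · intro j x hx
      rw [h.mem_iff, hq]
      exact hφ.map_mem _ _ hx
    · intro j a ha
      obtain ⟨x, hxm, hx⟩ := hφ.exists_lift j (f a) ((h.mem_iff _ _).1 ha)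
      refine ⟨⟨x, by rw [LinearMap.mem_ker, LinearMap.comp_apply, hx, h.exact]; exact ⟨a, rfl⟩⟩,
        hxm, h.inj ?_⟩
      rw [hq]; exact hx

/-- The grading of a product. -/
def prodGrading {A B : Type*} [AddCommGroup A] [AddCommGroup B]
    (𝒜 : ℤ → AddSubgroup A) (ℬ : ℤ → AddSubgroup B) (j : ℤ) : AddSubgroup (A × B) :=
  (𝒜 j).prod (ℬ j)

theorem isGrading_prodGrading {A B : Type (max u v)} [AddCommGroup A] [AddCommGroup B]
    [Module (MvPolynomial σ K) A] [Module (MvPolynomial σ K) B]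
    {𝒜 : ℤ → AddSubgroup A} {ℬ : ℤ → AddSubgroup B} (hA : IsGrading (σ := σ) (K := K) 𝒜)
    (hB : IsGrading (σ := σ) (K := K) ℬ) :
    IsGrading (σ := σ) (K := K) (prodGrading 𝒜 ℬ) := fun p d x j hp hx =>
  ⟨hA p d x.1 j hp hx.1, hB p d x.2 j hp hx.2⟩

theorem HasRes.prod (n : ℕ) {A B : Type (max u v)} [AddCommGroup A] [AddCommGroup B]
    [Module (MvPolynomial σ K) A] [Module (MvPolynomial σ K) B]
    {𝒜 : ℤ → AddSubgroup A} {ℬ : ℤ → AddSubgroup B} {r : ℤ}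
    (hA : IsGrading (σ := σ) (K := K) 𝒜) (hB : IsGrading (σ := σ) (K := K) ℬ)
    (h : HasRes (σ := σ) (K := K) n A 𝒜 r) (h' : HasRes (σ := σ) (K := K) n B ℬ r) :
    HasRes (σ := σ) (K := K) n (A × B) (prodGrading 𝒜 ℬ) r := by
  refine HasRes.horseshoe n (f := LinearMap.inl _ A B) (g := LinearMap.snd _ A B)
    ⟨isGrading_prodGrading hA hB, LinearMap.inl_injective, ?_, LinearMap.snd_surjective, ?_, ?_, ?_⟩
    h h'
  · rintro ⟨a, b⟩
    constructor
    · intro hb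
      exact ⟨a, Prod.ext rfl (Eq.symm hb)⟩
    · rintro ⟨a', h⟩
      exact (congrArg Prod.snd h).symm
  · intro j a
    exact (and_iff_left (zero_mem (ℬ j))).symm
  · intro j b hb
    exact hb.2
  · intro j b hb
    exact ⟨(0, b), ⟨zero_mem _, hb⟩, rfl⟩

/-- Finite graded resolutions with bounded shifts can be started from any graded free cover with
bounded shifts. -/
theorem HasRes.ker_of_ker (n : ℕ) {κ κ' : Type} [Fintype κ] [Fintype κ'] {s : κ → ℤ}
    {s' : κ' → ℤ} {M : Type (max u v)} [AddCommGroup M] [Module (MvPolynomial σ K) M]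
    {ℳ : ℤ → AddSubgroup M} {φ : (κ → MvPolynomial σ K) →ₗ[MvPolynomial σ K] M}
    {ψ : (κ' → MvPolynomial σ K) →ₗ[MvPolynomial σ K] M} {r : ℤ}
    (hφ : IsCover s ℳ φ) (hψ : IsCover s' ℳ ψ) (hs : ∀ a, s a ≤ r) (hs' : ∀ a, s' a ≤ r)
    (h : HasRes (σ := σ) (K := K) n (LinearMap.ker φ) (kerGrading s φ) (r + 1)) :
    HasRes (σ := σ) (K := K) n (LinearMap.ker ψ) (kerGrading s' ψ) (r + 1) := by
  cases n with
  | zero => trivial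
  | succ n =>
    obtain ⟨α, hα, hαm⟩ := exists_graded_lift hφ.map_mem hψ
    obtain ⟨β, hβ, hβm⟩ := exists_graded_lift hψ.map_mem hφ
    have h1 : HasRes (σ := σ) (K := K) n (κ → MvPolynomial σ K) (vecGrading s) (r + 1 + 1) :=
      HasRes.of_free n fun a => by have := hs a; omega
    have h2 : HasRes (σ := σ) (K := K) (n + 1) (κ' → MvPolynomial σ K) (vecGrading s') (r + 1) :=
      HasRes.of_free _ fun a => by have := hs' a; omega
    -- A form of Schanuel's lemma: with `F`, `F'` the sources of `φ`, `ψ`, the maps `x ↦ (βαx - x,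
    -- αx)` and `(z, y) ↦ y - αβy + αz` give an exact sequence `0 → F → ker φ ⊕ F' → ker ψ → 0`.
    -- Both `F` and `F'` are free with shifts at most `r`, so the mapping cone yields the bound `r +
    -- 1` for `ker ψ`.
    let f : (κ → MvPolynomial σ K) →ₗ[MvPolynomial σ K]
        LinearMap.ker φ × (κ' → MvPolynomial σ K) :=
      ((β ∘ₗ α - LinearMap.id).codRestrict (LinearMap.ker φ) fun x => by
        simp [hα, hβ]).prod α
    let g : LinearMap.ker φ × (κ' → MvPolynomial σ K) →ₗ[MvPolynomial σ K] LinearMap.ker ψ :=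
      LinearMap.codRestrict (LinearMap.ker ψ)
        ((LinearMap.id - α ∘ₗ β) ∘ₗ LinearMap.snd _ _ _ +
          α ∘ₗ (LinearMap.ker φ).subtype ∘ₗ LinearMap.fst _ _ _) fun x => by
            simp [hα, hβ]
    have hf1 : ∀ x, ((f x).1 : κ → MvPolynomial σ K) = β (α x) - x := fun x => rfl
    have hf2 : ∀ x, (f x).2 = α x := fun x => rfl
    have hg : ∀ x, (g x : κ' → MvPolynomial σ K) = x.2 - α (β x.2) + α x.1 := fun x => rfl
    refine HasRes.cone n (f := f) (g := g)
      ⟨isGrading_prodGrading (isGrading_kerGrading _ _) (isGrading_vecGrading _), ?_, ?_, ?_, ?_,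
        ?_, ?_⟩ h1 (HasRes.prod _ (isGrading_kerGrading _ _) (isGrading_vecGrading _) h h2)
    · rw [injective_iff_map_eq_zero]
      intro x hx
      have e2 := hf2 x
      have e1 := hf1 x
      rw [hx] at e1 e2
      rw [← e2] at e1
      simpa using e1.symm
    · intro x
      constructor
      · intro hx
        have e := hg x
        rw [hx, Submodule.coe_zero] at e
        have e' : x.2 = α (β x.2 - x.1) := by
          rw [map_sub]; linear_combination (exp := 1) -e
        refine ⟨β x.2 - x.1, Prod.ext (Subtype.ext ?_) ?_⟩
        · rw [hf1, ← e']; abel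
        · rw [hf2, ← e']
      · rintro ⟨y, rfl⟩
        refine Subtype.ext ?_
        rw [hg, hf1, hf2, map_sub, Submodule.coe_zero]
        abel
    · intro y
      refine ⟨(⟨β y, by rw [LinearMap.mem_ker, hβ]; exact y.2⟩, y), Subtype.ext ?_⟩
      rw [hg]; simp
    · intro j x
      constructor
      · intro hx
        exact ⟨sub_mem (hβm _ _ (hαm _ _ hx)) hx, hαm _ _ hx⟩
      · rintro ⟨hx1, hx2⟩
        have := sub_mem (hβm _ _ hx2) (mem_kerGrading.1 hx1)
        rw [hf1, hf2] at this
        simpa using this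
    · intro j x hx
      rw [mem_kerGrading, hg]
      exact add_mem (sub_mem hx.2 (hαm _ _ (hβm _ _ hx.2))) (hαm _ _ hx.1)
    · intro j y hy
      refine ⟨(⟨β y, by rw [LinearMap.mem_ker, hβ]; exact y.2⟩, y),
        ⟨hβm _ _ hy, hy⟩, Subtype.ext ?_⟩
      rw [hg]; simp

/-- The basis degrees of a minimal graded free cover occur in every graded free cover. -/
theorem IsCover.exists_shift_eq {κ κ' : Type} [Fintype κ] [Fintype κ'] {s : κ → ℤ}
    {s' : κ' → ℤ} {M : Type (max u v)} [AddCommGroup M] [Module (MvPolynomial σ K) M]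
    {ℳ : ℤ → AddSubgroup M} {φ : (κ → MvPolynomial σ K) →ₗ[MvPolynomial σ K] M}
    {ψ : (κ' → MvPolynomial σ K) →ₗ[MvPolynomial σ K] M}
    (hφ : IsCover s ℳ φ) (hψ : IsCover s' ℳ ψ)
    (hmin : ∀ x ∈ LinearMap.ker ψ, ∀ a, MvPolynomial.constantCoeff (x a) = 0) (b : κ') :
    ∃ a, s a = s' b := by
  classical
  obtain ⟨α, hα, hαm⟩ := exists_graded_lift hψ.map_mem hφ
  obtain ⟨β, hβ, -⟩ := exists_graded_lift hφ.map_mem hψ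
  -- `β ∘ α - id` maps into `ker ψ`, so by minimality the diagonal entry of `β ∘ α` at `b` has
  -- constant term `1`. Hence some entry of `α` in column `b` has nonzero constant term, and
  -- homogeneity equates the two degrees.
  have h0 : MvPolynomial.constantCoeff ((β (α (Pi.single b 1)) - Pi.single b 1 :
      κ' → MvPolynomial σ K) b) = 0 :=
    hmin _ (by rw [LinearMap.mem_ker, map_sub, hβ, hα, sub_self]) b
  have hm := hαm _ _ (single_mem_vecGrading s' b)
  set y := α (Pi.single b 1) with hy
  have e : y = ∑ a, y a • (Pi.single a 1 : κ → MvPolynomial σ K) := by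
    simpa using (pi_eq_sum_univ' y)
  have h1 : MvPolynomial.constantCoeff ((β y) b) = 1 := by
    rw [Pi.sub_apply, Pi.single_eq_same, map_sub, map_one, sub_eq_zero] at h0
    exact h0
  rw [e, map_sum, Finset.sum_apply, map_sum] at h1
  have : ∃ a, MvPolynomial.constantCoeff (y a) ≠ 0 := by
    by_contra! hne
    have hz : ∀ a ∈ Finset.univ, MvPolynomial.constantCoeff
        (β (y a • (Pi.single a 1 : κ → MvPolynomial σ K)) b) = 0 := fun a _ => by
      rw [map_smul, Pi.smul_apply, smul_eq_mul, map_mul, hne, zero_mul]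
    rw [Finset.sum_eq_zero hz] at h1
    exact zero_ne_one h1
  obtain ⟨a, ha⟩ := this
  refine ⟨a, ?_⟩
  have := hm a 0 (by rwa [MvPolynomial.mem_support_iff])
  simpa using this

/-- A minimal graded free cover computes the first step of any resolution. -/
theorem HasRes.of_minimal_cover {κ : Type} [Fintype κ] {s : κ → ℤ}
    {M : Type (max u v)} [AddCommGroup M] [Module (MvPolynomial σ K) M]
    {ℳ : ℤ → AddSubgroup M} {φ : (κ → MvPolynomial σ K) →ₗ[MvPolynomial σ K] M} {r : ℤ}
    (hφ : IsCover s ℳ φ) (hmin : ∀ x ∈ LinearMap.ker φ, ∀ a, MvPolynomial.constantCoeff (x a) = 0)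
    (h : ∀ n, HasRes (σ := σ) (K := K) n M ℳ r) :
    (∀ a, s a ≤ r) ∧
      ∀ n, HasRes (σ := σ) (K := K) n (LinearMap.ker φ) (kerGrading s φ) (r + 1) := by
  have hs : ∀ a, s a ≤ r := by
    obtain ⟨κ', _, s', ψ, hs', hψ, -⟩ := h 1
    intro a
    obtain ⟨b, hb⟩ := hψ.exists_shift_eq hφ hmin a
    exact hb ▸ hs' b
  refine ⟨hs, fun n => ?_⟩
  obtain ⟨κ', _, s', ψ, hs', hψ, hr⟩ := h (n + 1)
  exact HasRes.ker_of_ker n hψ hφ hs' hs hr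

end Grading

/-! ### Homogeneous components, existence of minimal resolutions, and regularity. -/

section Minimal

variable {σ : Type u} {K : Type v} [Field K]

/-- The homogeneous component of degree `j` of a vector in a graded free module. -/
noncomputable def vecComponent {κ : Type} (s : κ → ℤ) (j : ℤ) :
    (κ → MvPolynomial σ K) →+ (κ → MvPolynomial σ K) where
  toFun x a := ∑ m ∈ (x a).support with (m.degree : ℤ) + s a = j,
    MvPolynomial.monomial m ((x a).coeff m)
  map_zero' := by funext a; simp
  map_add' x y := by
    classical
    have h : ∀ p : MvPolynomial σ K, ∀ a m, MvPolynomial.coeff m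
        (∑ m ∈ p.support with (m.degree : ℤ) + s a = j, MvPolynomial.monomial m (p.coeff m)) =
        if (m.degree : ℤ) + s a = j then p.coeff m else 0 := by
      intro p a m
      simp only [MvPolynomial.coeff_sum, MvPolynomial.coeff_monomial, Finset.sum_ite_eq',
        Finset.mem_filter, MvPolynomial.mem_support_iff]
      by_cases h1 : p.coeff m = 0 <;> simp [h1]
    funext a
    ext m
    rw [Pi.add_apply, Pi.add_apply, MvPolynomial.coeff_add, h, h, h, MvPolynomial.coeff_add]
    split_ifs <;> simp

theorem coeff_vecComponent {κ : Type} (s : κ → ℤ) (j : ℤ) (x : κ → MvPolynomial σ K) (a : κ)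
    (m : σ →₀ ℕ) : MvPolynomial.coeff m (vecComponent s j x a) =
      if (m.degree : ℤ) + s a = j then MvPolynomial.coeff m (x a) else 0 := by
  classical
  show MvPolynomial.coeff m (∑ m ∈ (x a).support with (m.degree : ℤ) + s a = j,
    MvPolynomial.monomial m ((x a).coeff m)) = _
  simp only [MvPolynomial.coeff_sum, MvPolynomial.coeff_monomial, Finset.sum_ite_eq',
    Finset.mem_filter, MvPolynomial.mem_support_iff]
  by_cases h1 : (x a).coeff m = 0 <;> simp [h1]

theorem vecComponent_mem {κ : Type} (s : κ → ℤ) (j : ℤ) (x : κ → MvPolynomial σ K) :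
    vecComponent s j x ∈ vecGrading s j := by
  intro a m hm
  rw [MvPolynomial.mem_support_iff, coeff_vecComponent] at hm
  by_contra h
  exact hm (if_neg h)

theorem vecComponent_of_mem {κ : Type} {s : κ → ℤ} {j : ℤ} {x : κ → MvPolynomial σ K}
    (hx : x ∈ vecGrading s j) (i : ℤ) : vecComponent s i x = if j = i then x else 0 := by
  funext a
  ext m
  rw [coeff_vecComponent]
  by_cases hm : MvPolynomial.coeff m (x a) = 0
  · split_ifs <;> simp [hm]
  · rw [hx a m (MvPolynomial.mem_support_iff.2 hm)]
    split_ifs <;> simp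

/-- Graded maps commute with taking homogeneous components. -/
theorem vecComponent_map {κ κ' : Type} [Fintype κ] {s : κ → ℤ} {s' : κ' → ℤ}
    {φ : (κ → MvPolynomial σ K) →ₗ[MvPolynomial σ K] (κ' → MvPolynomial σ K)}
    (hφ : ∀ j, ∀ x ∈ vecGrading s j, φ x ∈ vecGrading s' j) (j : ℤ) (x : κ → MvPolynomial σ K) :
    vecComponent s' j (φ x) = φ (vecComponent s j x) := by
  classical
  have key : ∀ (a : κ) (p : MvPolynomial σ K), vecComponent s' j (φ (Pi.single a p)) =
      φ (vecComponent s j (Pi.single a p)) := by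
    intro a p
    induction p using MvPolynomial.induction_on' with
    | monomial m c =>
      have hm : (Pi.single a (MvPolynomial.monomial m c) : κ → MvPolynomial σ K) ∈
          vecGrading s (m.degree + s a) := by
        have := isGrading_vecGrading s (MvPolynomial.monomial m c) m.degree _ _ (fun m' hm => by
          rw [Finset.mem_singleton.1 (MvPolynomial.support_monomial_subset hm)])
          (single_mem_vecGrading (σ := σ) (K := K) s a)
        rw [← Pi.single_smul] at this
        simpa using this
      rw [vecComponent_of_mem hm, vecComponent_of_mem (hφ _ _ hm)]
      split_ifs <;> simp
    | add p q hp hq => rw [Pi.single_add, map_add, map_add, map_add, map_add, hp, hq]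
  have e : x = ∑ a, Pi.single a (x a) := (Finset.univ_sum_single x).symm
  rw [e]
  simp only [map_sum, key]

/-- Turns the ungraded exactness in a resolution into graded exactness: the degree `j` component of
any preimage is again a preimage. -/
theorem exists_homogeneous_lift {κ κ' : Type} [Fintype κ] {s : κ → ℤ} {s' : κ' → ℤ}
    {φ : (κ → MvPolynomial σ K) →ₗ[MvPolynomial σ K] (κ' → MvPolynomial σ K)}
    (hφ : ∀ j, ∀ x ∈ vecGrading s j, φ x ∈ vecGrading s' j) (j : ℤ)
    (y : κ' → MvPolynomial σ K) (hy : y ∈ vecGrading s' j) (hr : y ∈ LinearMap.range φ) :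
    ∃ x ∈ vecGrading s j, φ x = y := by
  obtain ⟨x, rfl⟩ := hr
  refine ⟨vecComponent s j x, vecComponent_mem _ _ _, ?_⟩
  rw [← vecComponent_map hφ, vecComponent_of_mem hy, if_pos rfl]

/-- A submodule of a graded free module that contains the components of its elements. -/
def IsHomogeneousSubmodule {κ : Type} (s : κ → ℤ)
    (N : Submodule (MvPolynomial σ K) (κ → MvPolynomial σ K)) : Prop :=
  ∀ j, ∀ x ∈ N, vecComponent s j x ∈ N

theorem isHomogeneousSubmodule_ker {κ κ' : Type} [Fintype κ] {s : κ → ℤ} {s' : κ' → ℤ}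
    {φ : (κ → MvPolynomial σ K) →ₗ[MvPolynomial σ K] (κ' → MvPolynomial σ K)}
    (hφ : ∀ j, ∀ x ∈ vecGrading s j, φ x ∈ vecGrading s' j) :
    IsHomogeneousSubmodule s (LinearMap.ker φ) := fun j x hx => by
  rw [LinearMap.mem_ker, ← vecComponent_map hφ, LinearMap.mem_ker.1 hx, map_zero]

theorem exists_sum_vecComponent {κ : Type} [Fintype κ] (s : κ → ℤ) (x : κ → MvPolynomial σ K) :
    ∃ J : Finset ℤ, x = ∑ j ∈ J, vecComponent s j x := by
  classical
  refine ⟨Finset.univ.biUnion fun a => (x a).support.image fun m => (m.degree : ℤ) + s a, ?_⟩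
  funext a
  ext m
  rw [Finset.sum_apply, MvPolynomial.coeff_sum]
  simp only [coeff_vecComponent, Finset.sum_ite_eq]
  split_ifs with h
  · rfl
  · by_contra hm
    exact h (Finset.mem_biUnion.2 ⟨a, Finset.mem_univ _,
      Finset.mem_image_of_mem _ (MvPolynomial.mem_support_iff.2 hm)⟩)

theorem exists_homogeneous_generators [Finite σ] {κ : Type} [Fintype κ] {s : κ → ℤ}
    {N : Submodule (MvPolynomial σ K) (κ → MvPolynomial σ K)}
    (hN : IsHomogeneousSubmodule s N) :
    ∃ (n : ℕ) (s' : Fin n → ℤ) (g : Fin n → κ → MvPolynomial σ K),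
      (∀ b, g b ∈ vecGrading s (s' b)) ∧ Submodule.span _ (Set.range g) = N := by
  classical
  let H : Set (κ → MvPolynomial σ K) := {x | x ∈ N ∧ ∃ j, x ∈ vecGrading s j}
  have hH : Submodule.span (MvPolynomial σ K) H = N := by
    apply le_antisymm
    · exact Submodule.span_le.2 fun x hx => hx.1
    · intro x hx
      obtain ⟨J, hJ⟩ := exists_sum_vecComponent s x
      rw [hJ]
      exact Submodule.sum_mem _ fun j _ =>
        Submodule.subset_span ⟨hN j x hx, j, vecComponent_mem _ _ _⟩
  have hfg : (Submodule.span (MvPolynomial σ K) H).FG := IsNoetherian.noetherian _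
  obtain ⟨T, hT, hTs⟩ := Submodule.fg_span_iff_fg_span_finset_subset H |>.1 hfg
  have hTj : ∀ x : T, ∃ j, (x : κ → MvPolynomial σ K) ∈ vecGrading s j := fun x => (hT x.2).2
  choose j hj using hTj
  refine ⟨T.card, fun b => j (T.equivFin.symm b), fun b => T.equivFin.symm b, fun b => hj _, ?_⟩
  rw [← hH, hTs]
  congr 1
  ext x
  constructor
  · rintro ⟨b, rfl⟩
    exact (T.equivFin.symm b).2
  · intro hx
    exact ⟨T.equivFin ⟨x, hx⟩, by simp⟩

/-- Homogeneous submodules of graded free modules have minimal graded free covers. -/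
theorem exists_minimal_cover [Finite σ] {κ : Type} [Fintype κ] {s : κ → ℤ}
    {N : Submodule (MvPolynomial σ K) (κ → MvPolynomial σ K)}
    (hN : IsHomogeneousSubmodule s N) :
    ∃ (n : ℕ) (s' : Fin n → ℤ)
      (φ : (Fin n → MvPolynomial σ K) →ₗ[MvPolynomial σ K] (κ → MvPolynomial σ K)),
      (∀ j, ∀ x ∈ vecGrading s' j, φ x ∈ vecGrading s j) ∧ LinearMap.range φ = N ∧
      ∀ x ∈ LinearMap.ker φ, ∀ a, MvPolynomial.constantCoeff (x a) = 0 := by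
  classical
  -- The cover is built from a homogeneous generating family with as few members as possible.
  have hex := exists_homogeneous_generators hN
  obtain ⟨s', g, hg, hspan⟩ := Nat.find_spec hex
  have hmin := fun m hm => Nat.find_min hex (m := m) hm
  generalize Nat.find hex = n at s' g hg hspan hmin
  let φ := (Pi.basisFun (MvPolynomial σ K) (Fin n)).constr (MvPolynomial σ K) g
  have hφs : ∀ a, φ (Pi.single a 1) = g a := fun a => by
    rw [← Pi.basisFun_apply]; exact Module.Basis.constr_basis _ _ _ _
  have hφ : ∀ j, ∀ x ∈ vecGrading s' j, φ x ∈ vecGrading s j :=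
    map_mem_of_single (isGrading_vecGrading s) fun a => by rw [hφs]; exact hg a
  refine ⟨n, s', φ, hφ, ?_, ?_⟩
  · rw [← hspan]
    exact Module.Basis.constr_range _ _
  · intro x hx a
    by_contra hc
    -- If a syzygy had an entry with nonzero constant term at `a`, its component of degree `s' a`
    -- would be a syzygy whose entry at `a` is a nonzero constant. The generator `g a` would then be
    -- redundant, contradicting the choice of `n`.
    have hy : φ (vecComponent s' (s' a) x) = 0 := by
      rw [← vecComponent_map hφ, LinearMap.mem_ker.1 hx, map_zero]
    have hym := vecComponent_mem s' (s' a) x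
    have hya : vecComponent s' (s' a) x a = MvPolynomial.C (MvPolynomial.constantCoeff (x a)) := by
      ext m
      rw [coeff_vecComponent, MvPolynomial.coeff_C]
      rcases eq_or_ne m 0 with rfl | hm
      · simp [MvPolynomial.constantCoeff_eq]
      · rw [if_neg, if_neg hm.symm]
        intro h
        apply hm
        have : m.degree = 0 := by omega
        exact (Finsupp.degree_eq_zero_iff m).1 this
    generalize vecComponent s' (s' a) x = y at hy hym hya
    cases n with
    | zero => exact a.elim0
    | succ n =>
      refine hmin n (Nat.lt_succ_self n) ⟨fun b => s' (a.succAbove b), fun b => g (a.succAbove b),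
        fun b => hg _, ?_⟩
      rw [← hspan]
      apply le_antisymm
      · refine Submodule.span_mono ?_
        rintro _ ⟨b, rfl⟩
        exact ⟨_, rfl⟩
      · rw [Submodule.span_le]
        rintro _ ⟨b, rfl⟩
        by_cases hb : b = a
        · subst hb
          have e : φ y = ∑ c, y c • g c := by
            rw [Module.Basis.constr_apply_fintype]
            simp
          rw [hy, Fin.sum_univ_succAbove _ b, hya] at e
          have e' : g b = (MvPolynomial.C (-(MvPolynomial.constantCoeff (x b))⁻¹) : MvPolynomial σ K) •
              ∑ i, y (b.succAbove i) • g (b.succAbove i) := by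
            rw [eq_neg_of_add_eq_zero_right e.symm, smul_neg, smul_smul, ← map_mul, ← neg_smul,
              ← map_neg, neg_mul, neg_neg, inv_mul_cancel₀ hc, map_one, one_smul]
          rw [e']
          exact Submodule.smul_mem _ _ (Submodule.sum_mem _ fun i _ =>
            Submodule.smul_mem _ _ (Submodule.subset_span ⟨i, rfl⟩))
        · obtain ⟨i, rfl⟩ := Fin.exists_succAbove_eq hb
          exact Submodule.subset_span ⟨i, rfl⟩

/-- A homogeneous submodule of a graded free module of finite rank. -/
structure HomSubmodule (σ : Type u) (K : Type v) [Field K] where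
  rank : ℕ
  shift : Fin rank → ℤ
  carrier : Submodule (MvPolynomial σ K) (Fin rank → MvPolynomial σ K)
  isHomogeneous : IsHomogeneousSubmodule shift carrier

/-- The rank of a chosen minimal cover. -/
noncomputable def HomSubmodule.coverRank [Finite σ] (N : HomSubmodule σ K) : ℕ :=
  (exists_minimal_cover N.isHomogeneous).choose

/-- The degrees of a chosen minimal cover. -/
noncomputable def HomSubmodule.coverShift [Finite σ] (N : HomSubmodule σ K) :
    Fin N.coverRank → ℤ :=
  (exists_minimal_cover N.isHomogeneous).choose_spec.choose

/-- The map of a chosen minimal cover. -/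
noncomputable def HomSubmodule.cover [Finite σ] (N : HomSubmodule σ K) :
    (Fin N.coverRank → MvPolynomial σ K) →ₗ[MvPolynomial σ K] (Fin N.rank → MvPolynomial σ K) :=
  (exists_minimal_cover N.isHomogeneous).choose_spec.choose_spec.choose

theorem HomSubmodule.cover_spec [Finite σ] (N : HomSubmodule σ K) :
    (∀ j, ∀ x ∈ vecGrading N.coverShift j, N.cover x ∈ vecGrading N.shift j) ∧
      LinearMap.range N.cover = N.carrier ∧
      ∀ x ∈ LinearMap.ker N.cover, ∀ a, MvPolynomial.constantCoeff (x a) = 0 :=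
  (exists_minimal_cover N.isHomogeneous).choose_spec.choose_spec.choose_spec

/-- The first syzygy module. -/
noncomputable def HomSubmodule.syzygy [Finite σ] (N : HomSubmodule σ K) : HomSubmodule σ K where
  rank := N.coverRank
  shift := N.coverShift
  carrier := LinearMap.ker N.cover
  isHomogeneous := isHomogeneousSubmodule_ker N.cover_spec.1

/-- The iterated syzygy modules. -/
noncomputable def HomSubmodule.syzygies [Finite σ] (N : HomSubmodule σ K) : ℕ → HomSubmodule σ K
  | 0 => N
  | n + 1 => (N.syzygies n).syzygy

/-- The grading of a homogeneous ideal. -/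
noncomputable def idealGrading (I : Ideal (MvPolynomial σ K)) (j : ℤ) : AddSubgroup I :=
  (vecGrading (fun _ : Unit => (0 : ℤ)) j).comap
    (AddMonoidHom.mk' (fun (x : I) (_ : Unit) => (x : MvPolynomial σ K)) fun _ _ => rfl)

theorem mem_idealGrading {I : Ideal (MvPolynomial σ K)} {j : ℤ} {x : I} :
    x ∈ idealGrading I j ↔ ∀ m ∈ (x : MvPolynomial σ K).support, (m.degree : ℤ) = j := by
  constructor
  · intro h m hm
    simpa using h () m hm
  · intro h _ m hm
    simpa using h m hm

theorem isGrading_idealGrading (I : Ideal (MvPolynomial σ K)) :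
    IsGrading (σ := σ) (K := K) (idealGrading I) := fun p d x j hp hx =>
  isGrading_vecGrading (fun _ : Unit => (0 : ℤ)) p d (fun _ => (x : MvPolynomial σ K)) j hp hx

theorem nonempty_minimalResolution [Finite σ] {I : Ideal (MvPolynomial σ K)}
    (hI : ∀ x ∈ I, ∀ m ∈ x.support, MvPolynomial.monomial m (1 : K) ∈ I) :
    Nonempty (MinimalResolution I) := by
  classical
  let π : (Fin 1 → MvPolynomial σ K) →ₗ[MvPolynomial σ K] MvPolynomial σ K := LinearMap.proj 0
  have hπ : Function.Injective π := fun x y h => funext fun a => by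
    rw [Subsingleton.elim a 0]; exact h
  -- The ideal is viewed inside the free module of rank one, so that it starts the sequence of
  -- iterated syzygies.
  let N : HomSubmodule σ K := ⟨1, fun _ => 0, Submodule.comap π I, by
    intro j x hx
    have hx' : x 0 ∈ I := hx
    suffices h : ∑ m ∈ (x 0).support with (m.degree : ℤ) + 0 = j,
        MvPolynomial.monomial m ((x 0).coeff m) ∈ I from h
    refine Submodule.sum_mem _ fun m hm => ?_
    have := I.mul_mem_left (MvPolynomial.C ((x 0).coeff m)) (hI _ hx' m (Finset.mem_filter.1 hm).1)
    rwa [MvPolynomial.C_mul_monomial, mul_one] at this⟩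
  have hdeg : ∀ (b : Fin N.coverRank), ∀ m ∈ ((N.cover (Pi.single b 1)) 0).support,
      (m.degree : ℤ) = N.coverShift b := fun b m hm => by
    have := N.cover_spec.1 _ _ (single_mem_vecGrading N.coverShift b) 0 m hm
    rw [← this]
    exact (add_zero _).symm
  have hrange : LinearMap.range (π ∘ₗ (show (Fin N.coverRank → MvPolynomial σ K)
      →ₗ[MvPolynomial σ K] (Fin 1 → MvPolynomial σ K) from N.cover)) = I := by
    rw [LinearMap.range_comp]
    refine (congrArg (Submodule.map π) N.cover_spec.2.1).trans ?_
    exact Submodule.map_comap_eq_of_surjective (fun y => ⟨fun _ => y, rfl⟩) I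
  have hker : LinearMap.range N.syzygy.cover = LinearMap.ker (π ∘ₗ (show
      (Fin N.coverRank → MvPolynomial σ K) →ₗ[MvPolynomial σ K] (Fin 1 → MvPolynomial σ K)
      from N.cover)) := by
    refine N.syzygy.cover_spec.2.1.trans ?_
    rw [LinearMap.ker_comp, LinearMap.ker_eq_bot.2 hπ]
    rfl
  refine ⟨{
    -- The free module in homological degree `i` covers the `i`-th syzygy module and is the ambient
    -- module of the next one; hence the index `i + 1`.
    rank := fun i => (N.syzygies (i + 1)).rank
    shift := fun i => (N.syzygies (i + 1)).shift
    d := fun i => (N.syzygies (i + 1)).cover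
    aug := π ∘ₗ N.cover
    d_homogeneous := fun i b =>
      (N.syzygies (i + 1)).cover_spec.1 _ _ (single_mem_vecGrading (N.syzygies (i + 1)).coverShift b)
    aug_homogeneous := hdeg
    range_aug := hrange
    exact_zero := hker
    exact_succ := fun i => (N.syzygies (i + 2)).cover_spec.2.1
    minimal := fun i b a => (N.syzygies i).cover_spec.2.2 _ (by
      have : (N.syzygies (i + 1)).cover (Pi.single b 1) ∈ (N.syzygies (i + 1)).carrier := by
        rw [← (N.syzygies (i + 1)).cover_spec.2.1]; exact ⟨_, rfl⟩
      exact this) a }⟩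

/-! ### Comparison of minimal resolutions with bounded resolutions. -/

section Bounds

variable {I : Ideal (MvPolynomial σ K)} (F : MinimalResolution I)

theorem MinimalResolution.d_mem (i : ℕ) (j : ℤ) (x) (hx : x ∈ vecGrading (F.shift (i + 1)) j) :
    F.d i x ∈ vecGrading (F.shift i) j :=
  map_mem_of_single (isGrading_vecGrading (F.shift i)) (fun b => F.d_homogeneous i b) j x hx

theorem MinimalResolution.constantCoeff_of_mem_range (i : ℕ) (x)
    (hx : x ∈ LinearMap.range (F.d i)) (a) : MvPolynomial.constantCoeff (x a) = 0 := by
  classical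
  obtain ⟨y, rfl⟩ := hx
  have e : y = ∑ b, y b • (Pi.single b 1 : _ → MvPolynomial σ K) := by
    simpa using (pi_eq_sum_univ' y)
  rw [e, map_sum, Finset.sum_apply, map_sum]
  refine Finset.sum_eq_zero fun b _ => ?_
  rw [map_smul, Pi.smul_apply, smul_eq_mul, map_mul, F.minimal, mul_zero]

theorem MinimalResolution.aug_mem (x) : F.aug x ∈ I := by
  have : F.aug x ∈ LinearMap.range F.aug := ⟨x, rfl⟩
  rwa [F.range_aug] at this

theorem MinimalResolution.isCover_aug :
    IsCover (F.shift 0) (idealGrading I) (F.aug.codRestrict I F.aug_mem) := by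
  let ι : MvPolynomial σ K →ₗ[MvPolynomial σ K] (Unit → MvPolynomial σ K) :=
    LinearMap.pi fun _ => LinearMap.id
  have hm : ∀ j, ∀ x ∈ vecGrading (F.shift 0) j,
      (ι ∘ₗ F.aug) x ∈ vecGrading (fun _ : Unit => (0 : ℤ)) j :=
    map_mem_of_single (isGrading_vecGrading _) fun b _ m hm => by
      simpa using F.aug_homogeneous b m hm
  refine ⟨hm, fun y => ?_, fun j y hy => ?_⟩
  · obtain ⟨x, hx⟩ : (y : MvPolynomial σ K) ∈ LinearMap.range F.aug := by
      rw [F.range_aug]; exact y.2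
    exact ⟨x, Subtype.ext hx⟩
  · obtain ⟨x, hx⟩ : (y : MvPolynomial σ K) ∈ LinearMap.range F.aug := by
      rw [F.range_aug]; exact y.2
    obtain ⟨z, hz, hzy⟩ := exists_homogeneous_lift hm j (ι y) hy ⟨x, by
      rw [LinearMap.comp_apply, hx]⟩
    exact ⟨z, hz, Subtype.ext (congrFun hzy ())⟩

/-- The map `φ` is arbitrary so that both the augmentation and the differentials are covered. -/
theorem MinimalResolution.isCover_d {i : ℕ} {M : Type (max u v)} [AddCommGroup M]
    [Module (MvPolynomial σ K) M]
    {φ : (Fin (F.rank i) → MvPolynomial σ K) →ₗ[MvPolynomial σ K] M}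
    (h : LinearMap.range (F.d i) = LinearMap.ker φ) :
    IsCover (F.shift (i + 1)) (kerGrading (F.shift i) φ)
      ((F.d i).codRestrict (LinearMap.ker φ) fun x => h ▸ ⟨x, rfl⟩) := by
  refine ⟨F.d_mem i, fun y => ?_, fun j y hy => ?_⟩
  · obtain ⟨x, hx⟩ : (y : Fin (F.rank i) → MvPolynomial σ K) ∈ LinearMap.range (F.d i) := by
      rw [h]; exact y.2
    exact ⟨x, Subtype.ext hx⟩
  · obtain ⟨z, hz, hzy⟩ := exists_homogeneous_lift (F.d_mem i) j y hy (by rw [h]; exact y.2)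
    exact ⟨z, hz, Subtype.ext hzy⟩

theorem HasRes.ker_congr {n : ℕ} {κ : Type} {s : κ → ℤ} {M N : Type (max u v)} [AddCommGroup M]
    [Module (MvPolynomial σ K) M] [AddCommGroup N] [Module (MvPolynomial σ K) N]
    {φ : (κ → MvPolynomial σ K) →ₗ[MvPolynomial σ K] M}
    {ψ : (κ → MvPolynomial σ K) →ₗ[MvPolynomial σ K] N} {r : ℤ}
    (h : LinearMap.ker φ = LinearMap.ker ψ)
    (hr : HasRes (σ := σ) (K := K) n (LinearMap.ker φ) (kerGrading s φ) r) :
    HasRes (σ := σ) (K := K) n (LinearMap.ker ψ) (kerGrading s ψ) r := by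
  have := HasRes.equiv (c := 0) n (𝒩 := kerGrading s ψ) (LinearEquiv.ofEq _ _ h)
    (fun j x => by rw [add_zero]; rfl) hr
  rwa [add_zero] at this

/-- Any resolution bounds the degrees in the minimal resolution. -/
theorem MinimalResolution.shift_le {r : ℤ}
    (h : ∀ n, HasRes (σ := σ) (K := K) n I (idealGrading I) r) (i : ℕ) (b) :
    F.shift i b ≤ r + i := by
  have h0 := HasRes.of_minimal_cover F.isCover_aug (fun x hx =>
    F.constantCoeff_of_mem_range 0 x (by
      rw [F.exact_zero]; rwa [LinearMap.ker_codRestrict] at hx)) h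
  have h1 : ∀ i : ℕ, (∀ b, F.shift (i + 1) b ≤ r + i + 1) ∧
      ∀ n, HasRes (σ := σ) (K := K) n (LinearMap.ker (F.d i))
        (kerGrading (F.shift (i + 1)) (F.d i)) (r + i + 1 + 1) := by
    intro i
    induction i with
    | zero =>
      have := HasRes.of_minimal_cover (F.isCover_d F.exact_zero) (fun x hx =>
        F.constantCoeff_of_mem_range 1 x (by
          rw [F.exact_succ]; rwa [LinearMap.ker_codRestrict] at hx))
        (fun n => HasRes.ker_congr (by rw [LinearMap.ker_codRestrict]) (h0.2 n))
      refine ⟨fun b => by simpa using this.1 b, fun n => ?_⟩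
      rw [Nat.cast_zero, add_zero]
      exact HasRes.ker_congr (by rw [LinearMap.ker_codRestrict]) (this.2 n)
    | succ i ih =>
      have := HasRes.of_minimal_cover (F.isCover_d (F.exact_succ i)) (fun x hx =>
        F.constantCoeff_of_mem_range (i + 2) x (by
          rw [F.exact_succ]; rwa [LinearMap.ker_codRestrict] at hx)) ih.2
      rw [Nat.cast_succ, ← add_assoc r]
      exact ⟨this.1, fun n => HasRes.ker_congr (by rw [LinearMap.ker_codRestrict]) (this.2 n)⟩
  cases i with
  | zero => simpa using h0.1 b
  | succ i =>
    have := (h1 i).1 b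
    push_cast
    omega

/-- The converse of `MinimalResolution.shift_le`; together they transport a bound from one minimal
resolution to any other. -/
theorem MinimalResolution.hasRes {r : ℤ} (h : ∀ i b, F.shift i b ≤ r + i) (n : ℕ) :
    HasRes (σ := σ) (K := K) n I (idealGrading I) r := by
  have h1 : ∀ n i : ℕ, HasRes (σ := σ) (K := K) n (LinearMap.ker (F.d i))
        (kerGrading (F.shift (i + 1)) (F.d i)) (r + i + 1 + 1) := by
    intro n
    induction n with
    | zero => intros; trivial
    | succ n ih =>
      intro i
      refine ⟨_, inferInstance, _, _, fun a => ?_, F.isCover_d (F.exact_succ i), ?_⟩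
      · have := h (i + 2) a
        push_cast at this
        linarith
      · refine HasRes.ker_congr (LinearMap.ker_codRestrict _ _ _).symm ?_
        have := ih (i + 1)
        rwa [Nat.cast_succ, ← add_assoc r] at this
  cases n with
  | zero => trivial
  | succ n =>
    refine ⟨_, inferInstance, _, _, fun a => by simpa using h 0 a, F.isCover_aug,
      HasRes.ker_congr (LinearMap.ker_codRestrict _ _ _).symm ?_⟩
    cases n with
    | zero => trivial
    | succ n =>
      refine ⟨_, inferInstance, _, _, fun a => by simpa using h 1 a, F.isCover_d F.exact_zero, ?_⟩
      refine HasRes.ker_congr (LinearMap.ker_codRestrict _ _ _).symm ?_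
      simpa using h1 n 0

theorem MinimalResolution.betti_ne_zero_iff {i : ℕ} {j : ℤ} :
    F.betti i j ≠ 0 ↔ ∃ b, F.shift i b = j := by
  rw [MinimalResolution.betti, Finset.card_ne_zero, Finset.Nonempty]
  simp

/-- Degrees of minimal monomial generators occur in homological degree zero. -/
theorem MinimalResolution.exists_shift_eq_degree
    (hI : ∀ x ∈ I, ∀ m ∈ x.support, MvPolynomial.monomial m (1 : K) ∈ I)
    {m : σ →₀ ℕ} (hm : m ∈ minimalMonomials I) : ∃ b, F.shift 0 b = m.degree := by
  classical
  obtain ⟨x, hx⟩ : MvPolynomial.monomial m (1 : K) ∈ LinearMap.range F.aug := by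
    rw [F.range_aug]; exact hm.1
  have e : x = ∑ b, x b • (Pi.single b 1 : _ → MvPolynomial σ K) := by
    simpa using (pi_eq_sum_univ' x)
  have hc : MvPolynomial.coeff m (F.aug x) ≠ 0 := by
    rw [hx, MvPolynomial.coeff_monomial, if_pos rfl]; exact one_ne_zero
  rw [e, map_sum, MvPolynomial.coeff_sum] at hc
  -- Some basis vector has an image containing a monomial `m2` that divides `m`. As `I` is a
  -- monomial ideal, `m2` lies in `I`, and minimality forces `m2 = m`.
  obtain ⟨b, -, hb⟩ := Finset.exists_ne_zero_of_sum_ne_zero hc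
  rw [map_smul, smul_eq_mul] at hb
  obtain ⟨m1, h1, m2, h2, h12⟩ := Finset.mem_add.1
    (MvPolynomial.support_mul _ _ (MvPolynomial.mem_support_iff.2 hb))
  have hle : m2 ≤ m := h12 ▸ le_add_self
  have : m = m2 := le_antisymm (hm.2 (hI _ (F.aug_mem _) m2 h2) hle) hle
  exact ⟨b, by rw [this]; exact (F.aug_homogeneous b m2 h2).symm⟩

end Bounds

/-- A nonzero monomial ideal with a resolution with bounded shifts has a regularity, which is at
most the bound and at least the degree of each minimal generator. -/
theorem exists_hasRegularity [Finite σ] {I : Ideal (MvPolynomial σ K)}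
    (hI : ∀ x ∈ I, ∀ m ∈ x.support, MvPolynomial.monomial m (1 : K) ∈ I) {r : ℤ}
    (h : ∀ n, HasRes (σ := σ) (K := K) n I (idealGrading I) r) {m : σ →₀ ℕ}
    (hm : m ∈ minimalMonomials I) :
    ∃ t : ℤ, HasRegularity I t ∧ (m.degree : ℤ) ≤ t ∧ t ≤ r := by
  have hset : ∀ F : MinimalResolution I, ∀ q : ℤ,
      (∀ n, HasRes (σ := σ) (K := K) n I (idealGrading I) q) →
      q ∈ upperBounds {t : ℤ | ∃ (i : ℕ) (j : ℤ), F.betti i j ≠ 0 ∧ t = j - i} := by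
    rintro F q hq _ ⟨i, j, hb, rfl⟩
    obtain ⟨b, rfl⟩ := F.betti_ne_zero_iff.1 hb
    have := F.shift_le hq i b
    omega
  have hdeg : ∀ F : MinimalResolution I,
      (m.degree : ℤ) ∈ {t : ℤ | ∃ (i : ℕ) (j : ℤ), F.betti i j ≠ 0 ∧ t = j - i} := by
    intro F
    obtain ⟨b, hb⟩ := F.exists_shift_eq_degree hI hm
    exact ⟨0, m.degree, F.betti_ne_zero_iff.2 ⟨b, hb⟩, by simp⟩
  have hgr : ∀ F : MinimalResolution I, ∃ q : ℤ,
      IsGreatest {t : ℤ | ∃ (i : ℕ) (j : ℤ), F.betti i j ≠ 0 ∧ t = j - i} q := fun F =>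
    Int.exists_greatest_of_bdd ⟨r, fun z hz => hset F r h hz⟩ ⟨_, hdeg F⟩ |>.imp fun q hq =>
      ⟨hq.1, fun z hz => hq.2 z hz⟩
  -- The maximum attained by one minimal resolution is a bound for resolutions of `I`, hence for the
  -- other one; by symmetry the two maxima agree.
  have hle : ∀ F F' : MinimalResolution I, ∀ q q' : ℤ,
      IsGreatest {t : ℤ | ∃ (i : ℕ) (j : ℤ), F.betti i j ≠ 0 ∧ t = j - i} q →
      IsGreatest {t : ℤ | ∃ (i : ℕ) (j : ℤ), F'.betti i j ≠ 0 ∧ t = j - i} q' → q' ≤ q := by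
    intro F F' q q' hq hq'
    refine hset F' q (F.hasRes fun i b => ?_) hq'.1
    have := hq.2 ⟨i, F.shift i b, F.betti_ne_zero_iff.2 ⟨b, rfl⟩, rfl⟩
    omega
  obtain ⟨F⟩ := nonempty_minimalResolution hI
  obtain ⟨q, hq⟩ := hgr F
  refine ⟨q, ⟨⟨F⟩, fun F' => ?_⟩, hq.2 (hdeg F), hset F r h hq.1⟩
  obtain ⟨q', hq'⟩ := hgr F'
  rwa [le_antisymm (hle F' F q' q hq' hq) (hle F F' q q' hq hq')]

end Minimal

/-! ### Monomial ideals and the splitting sequence. -/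

section Monomial

variable {σ : Type u} {K : Type v} [Field K]

/-- The monomial ideal with a given set of monomials. -/
def monoIdeal (K : Type v) [Field K] (U : UpperSet (σ →₀ ℕ)) : Ideal (MvPolynomial σ K) where
  carrier := {f | ∀ m ∈ f.support, m ∈ U}
  zero_mem' := by intro m hm; simp at hm
  add_mem' := by
    classical
    intro f g hf hg m hm
    rcases Finset.mem_union.1 (MvPolynomial.support_add hm) with h | h
    · exact hf m h
    · exact hg m h
  smul_mem' := by
    classical
    intro p f hf m hm
    obtain ⟨m1, -, m2, h2, rfl⟩ := Finset.mem_add.1 (MvPolynomial.support_mul _ _ hm)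
    exact U.upper le_add_self (hf m2 h2)

theorem mem_monoIdeal {U : UpperSet (σ →₀ ℕ)} {f : MvPolynomial σ K} :
    f ∈ monoIdeal K U ↔ ∀ m ∈ f.support, m ∈ U := Iff.rfl

theorem monomial_mem_monoIdeal {U : UpperSet (σ →₀ ℕ)} {m : σ →₀ ℕ} :
    MvPolynomial.monomial m (1 : K) ∈ monoIdeal K U ↔ m ∈ U := by
  classical
  rw [mem_monoIdeal, MvPolynomial.support_monomial, if_neg one_ne_zero]
  simp

theorem monomial_mem_of_mem_monoIdeal {U : UpperSet (σ →₀ ℕ)} (f : MvPolynomial σ K)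
    (hf : f ∈ monoIdeal K U) (m : σ →₀ ℕ) (hm : m ∈ f.support) :
    MvPolynomial.monomial m (1 : K) ∈ monoIdeal K U :=
  monomial_mem_monoIdeal.2 (hf m hm)

/-- The monomial ideal of `U` has graded resolutions with shifts at most `r + i` in homological
degree `i`. -/
def RegLE (K : Type v) [Field K] (U : UpperSet (σ →₀ ℕ)) (r : ℤ) : Prop :=
  ∀ n, HasRes (σ := σ) (K := K) n (monoIdeal K U) (idealGrading (monoIdeal K U)) r

theorem RegLE.mono {U : UpperSet (σ →₀ ℕ)} {r r' : ℤ} (h : RegLE K U r) (hr : r ≤ r') :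
    RegLE K U r' := fun n => (h n).mono hr

theorem regLE_Ici (w : σ →₀ ℕ) : RegLE K (UpperSet.Ici w) (w.degree : ℤ) := by
  classical
  intro n
  cases n with
  | zero => trivial
  | succ n =>
    have hw : MvPolynomial.monomial w (1 : K) ∈ monoIdeal K (UpperSet.Ici w) :=
      monomial_mem_monoIdeal.2 (UpperSet.mem_Ici_iff.2 le_rfl)
    let φ : (Unit → MvPolynomial σ K) →ₗ[MvPolynomial σ K] monoIdeal K (UpperSet.Ici w) :=
      (LinearMap.toSpanSingleton _ _ (⟨_, hw⟩ : monoIdeal K (UpperSet.Ici w))) ∘ₗ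
        LinearMap.proj ()
    have hφ : ∀ x, (φ x : MvPolynomial σ K) = x () * MvPolynomial.monomial w 1 := fun x => rfl
    have hinj : Function.Injective φ := by
      rw [injective_iff_map_eq_zero]
      intro x hx
      have e := hφ x
      rw [hx, Submodule.coe_zero, eq_comm, mul_eq_zero] at e
      funext _
      refine e.resolve_right fun h => ?_
      rw [MvPolynomial.monomial_eq_zero] at h
      exact one_ne_zero h
    have hmul : ∀ (p : MvPolynomial σ K) m,
        MvPolynomial.coeff (m + w) (p * MvPolynomial.monomial w 1) = MvPolynomial.coeff m p :=
      fun p m => by rw [MvPolynomial.coeff_mul_monomial, mul_one]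
    have hsurj : ∀ y : monoIdeal K (UpperSet.Ici w), ∃ x, φ x = y := by
      intro y
      refine ⟨fun _ => MvPolynomial.divMonomial (y : MvPolynomial σ K) w, Subtype.ext ?_⟩
      rw [hφ]
      ext m
      rw [MvPolynomial.coeff_mul_monomial', mul_one]
      split_ifs with h
      · rw [MvPolynomial.coeff_divMonomial, add_tsub_cancel_of_le h]
      · by_contra hne
        exact h (UpperSet.mem_Ici_iff.1 (y.2 m (MvPolynomial.mem_support_iff.2 (Ne.symm hne))))
    have hgr : ∀ j x, x ∈ vecGrading (fun _ : Unit => (w.degree : ℤ)) j ↔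
        φ x ∈ idealGrading (monoIdeal K (UpperSet.Ici w)) j := by
      intro j x
      rw [mem_idealGrading, hφ]
      constructor
      · intro hx m hm
        obtain ⟨m1, h1, m2, h2, rfl⟩ := Finset.mem_add.1 (MvPolynomial.support_mul _ _ hm)
        rw [Finset.mem_singleton.1 (MvPolynomial.support_monomial_subset h2), map_add]
        push_cast
        exact hx () m1 h1
      · intro hx a m hm
        have := hx (m + w) (by
          rw [MvPolynomial.mem_support_iff, hmul]; exact MvPolynomial.mem_support_iff.1 hm)
        rw [map_add] at this
        exact_mod_cast this
    refine ⟨Unit, inferInstance, fun _ => w.degree, φ, fun _ => le_rfl,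
      ⟨fun j x hx => (hgr j x).1 hx, hsurj, fun j y hy => ?_⟩, ?_⟩
    · obtain ⟨x, rfl⟩ := hsurj y
      exact ⟨x, (hgr j x).2 hy, rfl⟩
    · have : Subsingleton (LinearMap.ker φ) := by
        rw [LinearMap.ker_eq_bot.2 hinj]; infer_instance
      exact HasRes.of_subsingleton _ _ _

/-- If the monomials of `U` are those of `A` and `B`, and the common monomials of `A` and `B` are
the multiples by the variable `v` of those of `B`, then a bound for the regularity of `A` and `B`
is one for `U`. -/
theorem RegLE.of_union {U A B : UpperSet (σ →₀ ℕ)} (v : σ) {r : ℤ}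
    (hU : ∀ m, m ∈ U ↔ m ∈ A ∨ m ∈ B)
    (hAB : ∀ m, (m ∈ A ∧ m ∈ B) ↔ ∃ b ∈ B, b + Finsupp.single v 1 = m)
    (hA : RegLE K A r) (hB : RegLE K B r) : RegLE K U r := by
  classical
  intro n
  cases n with
  | zero => trivial
  | succ n =>
    have hAU : monoIdeal K A ≤ monoIdeal K U := fun f hf m hm => (hU m).2 (Or.inl (hf m hm))
    have hBU : monoIdeal K B ≤ monoIdeal K U := fun f hf m hm => (hU m).2 (Or.inr (hf m hm))
    have hXA : ∀ f ∈ monoIdeal K B, MvPolynomial.X v * f ∈ monoIdeal K A := by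
      intro f hf m hm
      rw [MvPolynomial.support_X_mul, Finset.mem_map] at hm
      obtain ⟨b, hb, rfl⟩ := hm
      refine ((hAB _).2 ⟨b, hf b hb, ?_⟩).1
      rw [add_comm]; rfl
    -- The sequence is `0 → B(-1) → A ⊕ B → U → 0` with first map `(x_v, -x_v)` and second map the
    -- sum.
    let f1 : monoIdeal K B →ₗ[MvPolynomial σ K] monoIdeal K A :=
      (LinearMap.lsmul (MvPolynomial σ K) (MvPolynomial σ K) (MvPolynomial.X v)).restrict hXA
    let f2 : monoIdeal K B →ₗ[MvPolynomial σ K] monoIdeal K B :=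
      LinearMap.lsmul (MvPolynomial σ K) (monoIdeal K B) (-MvPolynomial.X v)
    let f := f1.prod f2
    let g := (Submodule.inclusion hAU).coprod (Submodule.inclusion hBU)
    have hf1 : ∀ x, ((f x).1 : MvPolynomial σ K) = MvPolynomial.X v * (x : MvPolynomial σ K) :=
      fun x => rfl
    have hf2 : ∀ x, ((f x).2 : MvPolynomial σ K) = -MvPolynomial.X v * (x : MvPolynomial σ K) :=
      fun x => rfl
    have hg : ∀ x, (g x : MvPolynomial σ K) = x.1 + x.2 := fun x => rfl
    have hlift : ∀ c : monoIdeal K U, ∃ b : monoIdeal K A × monoIdeal K B, g b = c ∧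
        (∀ m ∈ (b.1 : MvPolynomial σ K).support, m ∈ (c : MvPolynomial σ K).support) ∧
        ∀ m ∈ (b.2 : MvPolynomial σ K).support, m ∈ (c : MvPolynomial σ K).support := by
      intro c
      -- An element of `U` is split by collecting its monomials in `A`; the remaining ones lie in
      -- `B`. No new monomials arise, so degrees are kept.
      let p : MvPolynomial σ K := ∑ m ∈ (c : MvPolynomial σ K).support with m ∈ A,
        MvPolynomial.monomial m (MvPolynomial.coeff m (c : MvPolynomial σ K))
      have hp : ∀ m, MvPolynomial.coeff m p =
          if m ∈ A then MvPolynomial.coeff m (c : MvPolynomial σ K) else 0 := by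
        intro m
        simp only [p, MvPolynomial.coeff_sum, MvPolynomial.coeff_monomial, Finset.sum_ite_eq',
          Finset.mem_filter, MvPolynomial.mem_support_iff]
        by_cases h1 : MvPolynomial.coeff m (c : MvPolynomial σ K) = 0 <;> simp [h1]
      have h1 : ∀ m ∈ p.support, m ∈ A ∧ m ∈ (c : MvPolynomial σ K).support := by
        intro m hm
        rw [MvPolynomial.mem_support_iff, hp] at hm
        split_ifs at hm with h
        · exact ⟨h, MvPolynomial.mem_support_iff.2 hm⟩
        · exact absurd rfl hm
      have h2 : ∀ m ∈ ((c : MvPolynomial σ K) - p).support,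
          m ∈ B ∧ m ∈ (c : MvPolynomial σ K).support := by
        intro m hm
        rw [MvPolynomial.mem_support_iff, MvPolynomial.coeff_sub, hp] at hm
        split_ifs at hm with h
        · exact absurd (sub_self _) hm
        · rw [sub_zero] at hm
          have := MvPolynomial.mem_support_iff.2 hm
          exact ⟨((hU m).1 (c.2 m this)).resolve_left h, this⟩
      exact ⟨(⟨p, fun m hm => (h1 m hm).1⟩, ⟨(c : MvPolynomial σ K) - p, fun m hm => (h2 m hm).1⟩),
        Subtype.ext (add_sub_cancel _ _), fun m hm => (h1 m hm).2, fun m hm => (h2 m hm).2⟩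
    -- The twist raises the bound for `B` to `r + 1`, which is what the mapping cone allows for its
    -- first term, so `r` itself does not grow.
    have hB' : HasRes (σ := σ) (K := K) n (monoIdeal K B)
        (fun j => idealGrading (monoIdeal K B) (j - 1)) (r + 1) :=
      HasRes.equiv n (LinearEquiv.refl _ _) (fun j x => by
        rw [add_sub_cancel_right]; rfl) (hB n)
    refine HasRes.cone n (f := f) (g := g)
      ⟨isGrading_prodGrading (isGrading_idealGrading _) (isGrading_idealGrading _),
        ?_, ?_, ?_, ?_, ?_, ?_⟩ hB'
      (HasRes.prod _ (isGrading_idealGrading _) (isGrading_idealGrading _) (hA _) (hB _))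
    · rw [injective_iff_map_eq_zero]
      intro x hx
      have e := hf1 x
      rw [hx, Prod.fst_zero, Submodule.coe_zero, eq_comm, mul_eq_zero] at e
      exact Subtype.ext (e.resolve_left (MvPolynomial.X_ne_zero v))
    · rintro ⟨a, b⟩
      constructor
      · intro h
        have e := hg (a, b)
        rw [h, Submodule.coe_zero] at e
        have eb : (b : MvPolynomial σ K) = -a := (neg_eq_of_add_eq_zero_right e.symm).symm
        have ha : ∀ m ∈ (a : MvPolynomial σ K).support, ∃ b ∈ B, b + Finsupp.single v 1 = m := by
          intro m hm
          refine (hAB m).1 ⟨a.2 m hm, b.2 m ?_⟩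
          rw [eb]; simpa using hm
        let p : MvPolynomial σ K := MvPolynomial.divMonomial (a : MvPolynomial σ K) (Finsupp.single v 1)
        have hp : p ∈ monoIdeal K B := by
          intro m hm
          rw [MvPolynomial.mem_support_iff, MvPolynomial.coeff_divMonomial] at hm
          obtain ⟨b', hb', h'⟩ := ha _ (MvPolynomial.mem_support_iff.2 hm)
          rw [add_comm] at h'
          rwa [← add_left_cancel h']
        have hXp : MvPolynomial.X v * p = (a : MvPolynomial σ K) := by
          ext m
          rw [MvPolynomial.X, MvPolynomial.coeff_monomial_mul', one_mul]
          split_ifs with h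
          · rw [MvPolynomial.coeff_divMonomial, add_tsub_cancel_of_le h]
          · by_contra hne
            obtain ⟨b', -, rfl⟩ := ha m (MvPolynomial.mem_support_iff.2 (Ne.symm hne))
            exact h le_add_self
        refine ⟨⟨p, hp⟩, Prod.ext (Subtype.ext ?_) (Subtype.ext ?_)⟩
        · rw [hf1]; exact hXp
        · rw [hf2, neg_mul, eb]; exact congrArg _ hXp
      · rintro ⟨x, h⟩
        refine Subtype.ext ?_
        rw [← h, hg, hf1, hf2, Submodule.coe_zero]
        ring
    · intro c
      exact (hlift c).imp fun b hb => hb.1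
    · intro j x
      have hx : ∀ j, x ∈ idealGrading (monoIdeal K B) (j - 1) ↔
          (f x).1 ∈ idealGrading (monoIdeal K A) j := by
        intro j
        rw [mem_idealGrading, mem_idealGrading, hf1, MvPolynomial.support_X_mul]
        simp only [Finset.mem_map, addLeftEmbedding_apply, forall_exists_index, and_imp,
          forall_apply_eq_imp_iff₂, map_add, Finsupp.degree_single]
        push_cast
        exact forall_congr' fun m => forall_congr' fun _ => by constructor <;> intro h <;> omega
      refine (hx j).trans (iff_self_and.2 fun h => ?_)
      rw [mem_idealGrading] at h
      refine mem_idealGrading.2 ?_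
      rw [hf2, neg_mul, MvPolynomial.support_neg]
      exact h
    · intro j b hb
      refine mem_idealGrading.2 fun m hm => ?_
      rw [hg] at hm
      rcases Finset.mem_union.1 (MvPolynomial.support_add hm) with h | h
      · exact mem_idealGrading.1 hb.1 m h
      · exact mem_idealGrading.1 hb.2 m h
    · intro j c hc
      obtain ⟨b, hb, h1, h2⟩ := hlift c
      exact ⟨b, ⟨mem_idealGrading.2 fun m hm => mem_idealGrading.1 hc m (h1 m hm),
        mem_idealGrading.2 fun m hm => mem_idealGrading.1 hc m (h2 m hm)⟩, hb⟩

end Monomial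

/-! ### Independent domination in claw-free graphs. -/

section Graph

variable {V : Type u} {G : SimpleGraph V}

theorem ClawFree.elim (hG : ClawFree G) {c a b d : V} (ha : G.Adj c a) (hb : G.Adj c b)
    (hd : G.Adj c d) (hab : a ≠ b) (had : a ≠ d) (hbd : b ≠ d) (nab : ¬ G.Adj a b)
    (nad : ¬ G.Adj a d) (nbd : ¬ G.Adj b d) : False := by
  have ha' := ha.symm
  have hb' := hb.symm
  have hd' := hd.symm
  have nba : ¬ G.Adj b a := fun h => nab h.symm
  have nda : ¬ G.Adj d a := fun h => nad h.symm
  have ndb : ¬ G.Adj d b := fun h => nbd h.symm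
  let f : Fin 1 ⊕ Fin 3 → V := Sum.elim (fun _ => c) ![a, b, d]
  have hinj : Function.Injective f := by
    rintro (x | x) (y | y) h
    · rw [Subsingleton.elim x y]
    · fin_cases y
      · exact absurd h ha.ne
      · exact absurd h hb.ne
      · exact absurd h hd.ne
    · fin_cases x
      · exact absurd h ha.ne'
      · exact absurd h hb.ne'
      · exact absurd h hd.ne'
    · fin_cases x <;> fin_cases y <;> simp_all [f]
  have hadj : ∀ x y, G.Adj (f x) (f y) ↔ (completeBipartiteGraph (Fin 1) (Fin 3)).Adj x y := by
    rintro (x | x) (y | y)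
    · simp [f]
    · fin_cases y <;> simp [f, ha, hb, hd]
    · fin_cases x <;> simp [f, ha', hb', hd']
    · fin_cases x <;> fin_cases y <;> simp [f, nab, nad, nbd, nba, nda, ndb]
  exact hG ⟨⟨⟨f, hinj⟩, hadj _ _⟩⟩

/-- `D` is a dominating set of the subgraph induced on `W`. -/
def Dominates (G : SimpleGraph V) (W D : Finset V) : Prop :=
  D ⊆ W ∧ ∀ x ∈ W, x ∉ D → ∃ y ∈ D, G.Adj x y

/-- There are no edges between vertices of `D`. -/
def Independent (G : SimpleGraph V) (D : Finset V) : Prop :=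
  ∀ x ∈ D, ∀ y ∈ D, ¬ G.Adj x y

/-- In a claw-free graph there is an independent dominating set that is at most as large as a given
dominating set. -/
theorem ClawFree.exists_independent_dominates (hG : ClawFree G) (W : Finset V) (n : ℕ) :
    ∀ D : Finset V, Dominates G W D → {x ∈ (D : Set V) | ∃ y ∈ D, G.Adj x y}.ncard ≤ n →
      ∃ A, Dominates G W A ∧ Independent G A ∧ A.card ≤ D.card := by
  classical
  induction n with
  | zero =>
    intro D hD hn
    refine ⟨D, hD, fun x hx y hy hxy => ?_, le_rfl⟩
    rw [Nat.le_zero, Set.ncard_eq_zero (D.finite_toSet.subset fun _ h => h.1)] at hn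
    have : x ∈ {x ∈ (D : Set V) | ∃ y ∈ D, G.Adj x y} := ⟨hx, y, hy, hxy⟩
    rw [hn] at this
    exact this
  | succ n ih =>
    intro D hD hn
    by_cases hind : Independent G D
    · exact ⟨D, hD, hind, le_rfl⟩
    unfold Independent at hind
    push Not at hind
    obtain ⟨v, hv, u, hu, hvu⟩ := hind
    have hfin : {x ∈ (D : Set V) | ∃ y ∈ D, G.Adj x y}.Finite :=
      D.finite_toSet.subset fun _ h => h.1
    -- The induction counts the vertices of `D` with a neighbor in `D`. Both modifications below
    -- remove `v` from this set and add nothing to it.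
    have hlt : ∀ D' : Finset V, {x ∈ (D' : Set V) | ∃ y ∈ D', G.Adj x y} ⊆
        {x ∈ (D : Set V) | ∃ y ∈ D, G.Adj x y} \ {v} →
        {x ∈ (D' : Set V) | ∃ y ∈ D', G.Adj x y}.ncard ≤ n := by
      intro D' h
      refine (Set.ncard_le_ncard h hfin.sdiff).trans ?_
      have hmem : v ∈ {x ∈ (D : Set V) | ∃ y ∈ D, G.Adj x y} := ⟨hv, u, hu, hvu⟩
      have := Set.ncard_sdiff_singleton_add_one hmem hfin
      omega
    -- If `v` has a private neighbor `w` outside `D`, then `v` is exchanged for `w`; otherwise `v`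
    -- is deleted, being itself dominated by `u`.
    by_cases hp : ∃ w ∈ W, w ∉ D ∧ G.Adj w v ∧ ∀ y ∈ D, G.Adj w y → y = v
    · obtain ⟨w, hwW, hwD, hwv, hw⟩ := hp
      have hw' : ∀ y ∈ D.erase v, ¬ G.Adj w y := fun y hy h =>
        (Finset.mem_erase.1 hy).1 (hw y (Finset.mem_erase.1 hy).2 h)
      have hDom : Dominates G W (insert w (D.erase v)) := by
        refine ⟨Finset.insert_subset hwW ((Finset.erase_subset _ _).trans hD.1), fun x hx hxD => ?_⟩
        rw [Finset.mem_insert, not_or, Finset.mem_erase, not_and'] at hxD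
        by_cases hxv : x = v
        · subst hxv
          exact ⟨w, Finset.mem_insert_self _ _, hwv.symm⟩
        have hxD' : x ∉ D := fun h => hxD.2 h hxv
        by_cases hy : ∃ y ∈ D, G.Adj x y ∧ y ≠ v
        · obtain ⟨y, hyD, hxy, hyv⟩ := hy
          exact ⟨y, Finset.mem_insert_of_mem (Finset.mem_erase.2 ⟨hyv, hyD⟩), hxy⟩
        · push Not at hy
          obtain ⟨y, hyD, hxy⟩ := hD.2 x hx hxD'
          obtain rfl := hy y hyD hxy
          refine ⟨w, Finset.mem_insert_self _ _, ?_⟩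
          -- Otherwise `v` is the center of a claw with leaves `x`, `w`, `u`: both `x` and `w` have
          -- `v` as their only neighbor in `D`, so neither is adjacent to `u`.
          by_contra hxw
          have hxu : ¬ G.Adj x u := fun h => hvu.ne (hy u hu h).symm
          have hwu : ¬ G.Adj w u := fun h => hvu.ne (hw u hu h).symm
          exact hG.elim hxy.symm hwv.symm hvu hxD.1 (fun h => hxD' (h ▸ hu))
            (fun h => hwD (h ▸ hu)) hxw hxu hwu
      obtain ⟨A, h1, h2, h3⟩ := ih _ hDom (hlt _ (by
        rintro x ⟨hx, y, hy, hxy⟩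
        rw [Finset.mem_coe, Finset.mem_insert] at hx
        rw [Finset.mem_insert] at hy
        rcases hx with rfl | hx
        · rcases hy with rfl | hy
          · exact absurd hxy (G.loopless.irrefl _)
          · exact absurd hxy (hw' y hy)
        · rcases hy with rfl | hy
          · exact absurd hxy.symm (hw' x hx)
          · rw [Finset.mem_erase] at hx hy
            exact ⟨⟨hx.2, y, hy.2, hxy⟩, hx.1⟩))
      refine ⟨A, h1, h2, h3.trans ?_⟩
      rw [Finset.card_insert_of_notMem (fun h => hwD (Finset.mem_erase.1 h).2)]
      exact (Finset.card_erase_add_one hv).le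
    · push Not at hp
      have hDom : Dominates G W (D.erase v) := by
        refine ⟨(Finset.erase_subset _ _).trans hD.1, fun x hx hxD => ?_⟩
        rw [Finset.mem_erase, not_and'] at hxD
        by_cases hxv : x = v
        · subst hxv
          exact ⟨u, Finset.mem_erase.2 ⟨hvu.ne', hu⟩, hvu⟩
        have hxD' : x ∉ D := fun h => hxD h hxv
        obtain ⟨y, hyD, hxy⟩ := hD.2 x hx hxD'
        by_cases hyv : y = v
        · subst hyv
          obtain ⟨z, hz, hxz, hzy⟩ := hp x hx hxD' hxy
          exact ⟨z, Finset.mem_erase.2 ⟨hzy, hz⟩, hxz⟩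
        · exact ⟨y, Finset.mem_erase.2 ⟨hyv, hyD⟩, hxy⟩
      obtain ⟨A, h1, h2, h3⟩ := ih _ hDom (hlt _ (by
        rintro x ⟨hx, y, hy, hxy⟩
        rw [Finset.mem_coe, Finset.mem_erase] at hx
        rw [Finset.mem_erase] at hy
        exact ⟨⟨hx.2, y, hy.2, hxy⟩, hx.1⟩))
      exact ⟨A, h1, h2, h3.trans (Finset.card_erase_le)⟩

theorem exists_dominates_independent (G : SimpleGraph V) (W : Finset V) :
    ∃ A, Dominates G W A ∧ Independent G A := by
  classical
  obtain ⟨A, hA, hmax⟩ := Finset.exists_max_image (W.powerset.filter (Independent G))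
    Finset.card ⟨∅, by simp [Independent]⟩
  rw [Finset.mem_filter, Finset.mem_powerset] at hA
  refine ⟨A, ⟨hA.1, fun x hx hxA => ?_⟩, hA.2⟩
  by_contra! h
  have := hmax (insert x A) (by
    rw [Finset.mem_filter, Finset.mem_powerset]
    refine ⟨Finset.insert_subset hx hA.1, fun a ha b hb hab => ?_⟩
    rw [Finset.mem_insert] at ha hb
    rcases ha with rfl | ha <;> rcases hb with rfl | hb
    · exact G.loopless.irrefl _ hab
    · exact h b hb hab
    · exact h a ha hab.symm
    · exact hA.2 a ha b hb hab)
  rw [Finset.card_insert_of_notMem hxA] at this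
  omega

/-- In a claw-free graph without isolated vertices some independent dominating set contains at most
half of the vertices. -/
theorem ClawFree.exists_two_mul_card_le (hG : ClawFree G) (W : Finset V)
    (hW : ∀ x ∈ W, ∃ y ∈ W, G.Adj x y) :
    ∃ A, Dominates G W A ∧ Independent G A ∧ 2 * A.card ≤ W.card := by
  classical
  obtain ⟨A, hA, hind⟩ := exists_dominates_independent G W
  by_cases h : 2 * A.card ≤ W.card
  · exact ⟨A, hA, hind, h⟩
  -- Without isolated vertices the complement of an independent set dominates; here it has fewer
  -- than half of the vertices.
  have hD : Dominates G W (W \ A) := by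
    refine ⟨Finset.sdiff_subset, fun x hx hxA => ?_⟩
    have hxA' : x ∈ A := by
      by_contra h
      exact hxA (Finset.mem_sdiff.2 ⟨hx, h⟩)
    obtain ⟨y, hy, hxy⟩ := hW x hx
    exact ⟨y, Finset.mem_sdiff.2 ⟨hy, fun hyA => hind x hxA' y hyA hxy⟩, hxy⟩
  obtain ⟨B, h1, h2, h3⟩ := hG.exists_independent_dominates W _ _ hD le_rfl
  refine ⟨B, h1, h2, ?_⟩
  rw [Finset.card_sdiff_of_subset hA.1] at h3
  omega

/-- There is an independent dominating set of least size. -/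
theorem ClawFree.exists_min_independent_dominates (hG : ClawFree G) (W : Finset V)
    (hW : ∀ x ∈ W, ∃ y ∈ W, G.Adj x y) :
    ∃ A, Dominates G W A ∧ Independent G A ∧ 2 * A.card ≤ W.card ∧
      ∀ B, Dominates G W B → Independent G B → A.card ≤ B.card := by
  classical
  obtain ⟨A₀, h1, h2, h3⟩ := hG.exists_two_mul_card_le W hW
  obtain ⟨A, hA, hmin⟩ := Finset.exists_min_image
    (W.powerset.filter fun A => Dominates G W A ∧ Independent G A) Finset.card
    ⟨A₀, Finset.mem_filter.2 ⟨Finset.mem_powerset.2 h1.1, h1, h2⟩⟩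
  rw [Finset.mem_filter] at hA
  refine ⟨A, hA.2.1, hA.2.2, ?_, fun B hB hB' =>
    hmin B (Finset.mem_filter.2 ⟨Finset.mem_powerset.2 hB.1, hB, hB'⟩)⟩
  have := hmin A₀ (Finset.mem_filter.2 ⟨Finset.mem_powerset.2 h1.1, h1, h2⟩)
  omega

end Graph

/-! ### The splitting procedure and its bookkeeping. -/

section Game

variable {V : Type u} (G : SimpleGraph V) (K : Type v) [Field K]

/-- The exponents that are at least `w` and have sum at least `k` on the edges inside `X`. -/
def coverSet (k : ℕ) (X : Finset V) (w : V → ℕ) : UpperSet (V →₀ ℕ) where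
  carrier := {m | (∀ x, w x ≤ m x) ∧ ∀ i ∈ X, ∀ j ∈ X, G.Adj i j → k ≤ m i + m j}
  upper' := fun _ _ h hm => ⟨fun x => (hm.1 x).trans (h x), fun i hi j hj hij =>
    (hm.2 i hi j hj hij).trans (add_le_add (h i) (h j))⟩

variable {G K}

theorem mem_coverSet {k : ℕ} {X : Finset V} {w : V → ℕ} {m : V →₀ ℕ} :
    m ∈ coverSet G k X w ↔
      (∀ x, w x ≤ m x) ∧ ∀ i ∈ X, ∀ j ∈ X, G.Adj i j → k ≤ m i + m j := Iff.rfl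

/-- Vertices whose edges impose no condition can be dropped. -/
theorem coverSet_congr {k : ℕ} {X Y : Finset V} {w : V → ℕ} (hXY : Y ⊆ X)
    (h : ∀ i ∈ X, ∀ j ∈ X, G.Adj i j → i ∉ Y → k ≤ w i + w j) :
    coverSet G k X w = coverSet G k Y w := by
  ext m
  rw [SetLike.mem_coe, SetLike.mem_coe, mem_coverSet, mem_coverSet]
  refine and_congr_right fun hm => ⟨fun hX i hi j hj => hX i (hXY hi) j (hXY hj),
    fun hY i hi j hj hij => ?_⟩
  by_cases hiY : i ∈ Y
  · by_cases hjY : j ∈ Y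
    · exact hY i hiY j hjY hij
    · rw [add_comm]
      exact (h j hj i hi hij.symm hjY).trans (add_le_add (hm j) (hm i))
  · exact (h i hi j hj hij hiY).trans (add_le_add (hm i) (hm j))

/-- A leaf of the splitting tree: the lower bounds imply all edge conditions, so the ideal is
principal of degree `∑ w`. -/
theorem regLE_coverSet_of_le [Fintype V] {k : ℕ} {X : Finset V} {w : V → ℕ} {r : ℕ}
    (h : ∀ i ∈ X, ∀ j ∈ X, G.Adj i j → k ≤ w i + w j) (hr : ∑ x, w x ≤ r) :
    RegLE K (coverSet G k X w) r := by
  have e : coverSet G k X w = UpperSet.Ici (Finsupp.equivFunOnFinite.symm w) := by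
    ext m
    rw [SetLike.mem_coe, SetLike.mem_coe, mem_coverSet, UpperSet.mem_Ici_iff]
    exact ⟨fun hm x => hm.1 x, fun hm => ⟨fun x => hm x, fun i hi j hj hij =>
      (h i hi j hj hij).trans (add_le_add (hm i) (hm j))⟩⟩
  rw [e]
  refine (regLE_Ici _).mono ?_
  rw [Finsupp.degree_eq_sum]
  exact_mod_cast hr

/-- Either the exponent of `v` is raised, or it is frozen and those of its neighbors are raised. -/
theorem regLE_coverSet_step [DecidableEq V] [DecidableRel G.Adj] {k : ℕ} {X : Finset V}
    {w : V → ℕ} {r : ℤ} {v : V} (hv : v ∈ X)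
    (hA : RegLE K (coverSet G k X (Function.update w v (w v + 1))) r)
    (hB : RegLE K (coverSet G k (X.erase v)
      fun x => if x ∈ X ∧ G.Adj v x then max (w x) (k - w v) else w x) r) :
    RegLE K (coverSet G k X w) r := by
  have hwle : ∀ x, w x ≤ if x ∈ X ∧ G.Adj v x then max (w x) (k - w v) else w x := by
    intro x; split_ifs
    · exact le_max_left _ _
    · exact le_rfl
  have hBU : ∀ m ∈ coverSet G k (X.erase v)
      (fun x => if x ∈ X ∧ G.Adj v x then max (w x) (k - w v) else w x),
      m ∈ coverSet G k X w := by
    rintro m ⟨h1, h2⟩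
    have hkey : ∀ j ∈ X, G.Adj v j → k ≤ m v + m j := by
      intro j hj hvj
      have e1 := (hwle v).trans (h1 v)
      have e2 := h1 j
      beta_reduce at e2
      rw [if_pos ⟨hj, hvj⟩] at e2
      have e3 := (le_max_right _ _).trans e2
      omega
    refine ⟨fun x => (hwle x).trans (h1 x), fun i hi j hj hij => ?_⟩
    by_cases hiv : i = v
    · subst hiv; exact hkey j hj hij
    by_cases hjv : j = v
    · subst hjv; rw [add_comm]; exact hkey i hi hij.symm
    · exact h2 i (Finset.mem_erase.2 ⟨hiv, hi⟩) j (Finset.mem_erase.2 ⟨hjv, hj⟩) hij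
  have hAmem : ∀ m, m ∈ coverSet G k X (Function.update w v (w v + 1)) ↔
      m ∈ coverSet G k X w ∧ w v + 1 ≤ m v := by
    intro m
    rw [mem_coverSet, mem_coverSet]
    constructor
    · rintro ⟨h1, h2⟩
      have hv' := h1 v
      rw [Function.update_self] at hv'
      refine ⟨⟨fun x => ?_, h2⟩, hv'⟩
      rcases eq_or_ne x v with rfl | hx
      · omega
      · have := h1 x
        rwa [Function.update_of_ne hx] at this
    · rintro ⟨⟨h1, h2⟩, hv'⟩
      refine ⟨fun x => ?_, h2⟩
      rcases eq_or_ne x v with rfl | hx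
      · rwa [Function.update_self]
      · rw [Function.update_of_ne hx]; exact h1 x
  -- In `B` the only condition left on `v` is `m v ≥ w v`, so requiring `m v ≥ w v + 1` as well
  -- amounts to multiplying by `x_v`.
  refine RegLE.of_union v (fun m => ?_) (fun m => ?_) hA hB
  · rw [hAmem]
    constructor
    · intro hm
      by_cases hmv : w v + 1 ≤ m v
      · exact Or.inl ⟨hm, hmv⟩
      · refine Or.inr ⟨fun x => ?_, fun i hi j hj => hm.2 i (Finset.mem_of_mem_erase hi) j
          (Finset.mem_of_mem_erase hj)⟩
        beta_reduce
        split_ifs with hx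
        · have := hm.2 v hv x hx.1 hx.2
          exact max_le (hm.1 x) (by omega)
        · exact hm.1 x
    · rintro (hm | hm)
      · exact hm.1
      · exact hBU m hm
  · rw [hAmem]
    constructor
    · rintro ⟨⟨-, hmv⟩, h1, h2⟩
      have hle : Finsupp.single v 1 ≤ m := by
        rw [Finsupp.single_le_iff]; omega
      have hne : ∀ x, x ≠ v → (m - Finsupp.single v 1 : V →₀ ℕ) x = m x := fun x hx => by
        rw [Finsupp.tsub_apply, Finsupp.single_eq_of_ne hx, tsub_zero]
      refine ⟨m - Finsupp.single v 1, ⟨fun x => ?_, fun i hi j hj hij => ?_⟩,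
        tsub_add_cancel_of_le hle⟩
      · rcases eq_or_ne x v with rfl | hx
        · beta_reduce
          rw [if_neg (fun h => G.loopless.irrefl _ h.2), Finsupp.tsub_apply,
            Finsupp.single_eq_same]
          omega
        · rw [hne x hx]; exact h1 x
      · rw [hne i (Finset.ne_of_mem_erase hi), hne j (Finset.ne_of_mem_erase hj)]
        exact h2 i hi j hj hij
    · rintro ⟨b, hb, rfl⟩
      have hm := (coverSet G k (X.erase v)
        (fun x => if x ∈ X ∧ G.Adj v x then max (w x) (k - w v) else w x)).upper
        (le_self_add : b ≤ b + Finsupp.single v 1) hb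
      refine ⟨⟨hBU _ hm, ?_⟩, hm⟩
      have := (hwle v).trans (hb.1 v)
      rw [Finsupp.add_apply, Finsupp.single_eq_same]
      omega

open Classical in
/-- The exponents after the vertices in `Z` have been frozen at `l` and those in `R` have been
raised by one. -/
noncomputable def roundWeight (G : SimpleGraph V) (W : Finset V) (k l : ℕ) (w : V → ℕ)
    (Z R : Finset V) (x : V) : ℕ :=
  if x ∈ W ∧ ∃ z ∈ Z, G.Adj z x then k - l else if x ∈ R then l + 1 else w x

open Classical in
/-- The vertices of `W` outside the closed neighborhood of `Z`. -/
noncomputable def alive (G : SimpleGraph V) (W Z : Finset V) : Finset V :=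
  {x ∈ W | x ∉ Z ∧ ∀ z ∈ Z, ¬ G.Adj z x}

theorem mem_alive {W Z : Finset V} {x : V} :
    x ∈ alive G W Z ↔ x ∈ W ∧ x ∉ Z ∧ ∀ z ∈ Z, ¬ G.Adj z x := by
  simp [alive]

theorem roundWeight_insert [DecidableEq V] {W : Finset V} {k l : ℕ} {w : V → ℕ} {Z R : Finset V}
    {v x : V} (hx : x ≠ v) :
    roundWeight G W k l w Z (insert v R) x = roundWeight G W k l w Z R x := by
  unfold roundWeight
  by_cases h1 : x ∈ W ∧ ∃ z ∈ Z, G.Adj z x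
  · rw [if_pos h1, if_pos h1]
  · rw [if_neg h1, if_neg h1]
    by_cases h2 : x ∈ R
    · rw [if_pos h2, if_pos (Finset.mem_insert_of_mem h2)]
    · rw [if_neg h2, if_neg (by simp [hx, h2])]

/-- One round, by induction on the set `T` of vertices still to be processed. The set `R` collects
raised vertices as well as those passed over because a neighbor is frozen; `roundWeight` gives
frozen neighborhoods precedence, so the latter do no harm. -/
theorem regLE_round [DecidableEq V] {k l : ℕ} (hkl : 2 * l + 1 ≤ k) {W T₀ : Finset V} (hT₀ : T₀ ⊆ W)
    {w : V → ℕ} (hw : ∀ x ∈ W, w x = l) {r : ℤ}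
    (hleaf : ∀ Z R, Z ∪ R = T₀ → Disjoint Z R → Independent G Z →
      RegLE K (coverSet G k (alive G W Z) (roundWeight G W k l w Z R)) r) (T : Finset V) :
    ∀ Z R, Z ∪ R ∪ T = T₀ → Disjoint Z R → Disjoint (Z ∪ R) T → Independent G Z →
      RegLE K (coverSet G k (alive G W Z) (roundWeight G W k l w Z R)) r := by
  classical
  induction T using Finset.induction_on with
  | empty =>
    intro Z R h1 h2 _ h4
    exact hleaf Z R (by simpa using h1) h2 h4
  | insert v T hvT ih =>
    intro Z R h1 h2 h3 h4
    rw [Finset.disjoint_insert_right] at h3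
    have hvZ : v ∉ Z := fun h => h3.1 (Finset.mem_union_left _ h)
    have hvR : v ∉ R := fun h => h3.1 (Finset.mem_union_right _ h)
    have hvW : v ∈ W := hT₀ (h1 ▸ by simp)
    have hraise := ih Z (insert v R) (by rw [← h1]; ext x; simp)
      (Finset.disjoint_insert_right.2 ⟨hvZ, h2⟩)
      (by
        rw [Finset.union_insert]
        exact Finset.disjoint_insert_left.2 ⟨hvT, h3.2⟩) h4
    -- A vertex with a frozen neighbor is no longer alive: it is moved to `R` without a splitting,
    -- and its weight stays `k - l`.
    by_cases hN : ∃ z ∈ Z, G.Adj z v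
    · convert hraise using 2
      funext x
      by_cases hxv : x = v
      · subst hxv
        unfold roundWeight
        rw [if_pos ⟨hvW, hN⟩, if_pos ⟨hvW, hN⟩]
      · exact (roundWeight_insert hxv).symm
    · have hN' : ∀ z ∈ Z, ¬ G.Adj z v := by push Not at hN; exact hN
      have hvl : roundWeight G W k l w Z R v = l := by
        rw [roundWeight, if_neg (fun h => hN h.2), if_neg hvR, hw v hvW]
      have hge : ∀ x ∈ W, l ≤ roundWeight G W k l w (insert v Z) R x := by
        intro x hx
        unfold roundWeight
        split_ifs
        · omega
        · omega
        · exact (hw x hx).ge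
      have hfreeze := ih (insert v Z) R (by rw [← h1]; ext x; simp)
        (Finset.disjoint_insert_left.2 ⟨hvR, h2⟩)
        (by
          rw [Finset.insert_union]
          exact Finset.disjoint_insert_left.2 ⟨hvT, h3.2⟩)
        (by
          intro a ha b hb hab
          rw [Finset.mem_insert] at ha hb
          rcases ha with rfl | ha <;> rcases hb with rfl | hb
          · exact G.loopless.irrefl _ hab
          · exact hN' b hb hab.symm
          · exact hN' a ha hab
          · exact h4 a ha b hb hab)
      refine regLE_coverSet_step (v := v) (mem_alive.2 ⟨hvW, hvZ, hN'⟩) ?_ ?_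
      · convert hraise using 2
        funext x
        rcases eq_or_ne x v with rfl | hx
        · rw [Function.update_self, hvl, roundWeight, if_neg (fun h => hN h.2),
            if_pos (Finset.mem_insert_self _ _)]
        · rw [Function.update_of_ne hx, roundWeight_insert hx]
      · have hweq : (fun x => if x ∈ alive G W Z ∧ G.Adj v x then
            max (roundWeight G W k l w Z R x) (k - roundWeight G W k l w Z R v)
            else roundWeight G W k l w Z R x) = roundWeight G W k l w (insert v Z) R := by
          funext x
          rw [hvl]
          by_cases hxW : x ∈ W
          · by_cases hxN : ∃ z ∈ Z, G.Adj z x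
            · rw [if_neg (fun h => by
                obtain ⟨z, hz, hzx⟩ := hxN
                exact (mem_alive.1 h.1).2.2 z hz hzx)]
              unfold roundWeight
              rw [if_pos ⟨hxW, hxN⟩, if_pos ⟨hxW, by
                obtain ⟨z, hz, hzx⟩ := hxN
                exact ⟨z, Finset.mem_insert_of_mem hz, hzx⟩⟩]
            · by_cases hvx : G.Adj v x
              · have hxZ : x ∉ Z := fun h => hN' x h hvx.symm
                rw [if_pos ⟨mem_alive.2 ⟨hxW, hxZ, by push Not at hxN; exact hxN⟩, hvx⟩]
                unfold roundWeight
                rw [if_neg (fun h => hxN h.2),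
                  if_pos (⟨hxW, v, Finset.mem_insert_self _ _, hvx⟩ : x ∈ W ∧ _), hw x hxW]
                -- The new weight is `max (l + 1) (k - l)` or `max l (k - l)`, both equal to `k - l`
                -- because `2 * l + 1 ≤ k`.
                split_ifs <;> omega
              · rw [if_neg (fun h => hvx h.2)]
                have h1 : ¬ (x ∈ W ∧ ∃ z ∈ Z, G.Adj z x) := fun h => hxN h.2
                have h2 : ¬ (x ∈ W ∧ ∃ z ∈ insert v Z, G.Adj z x) := by
                  rintro ⟨-, z, hz, hzx⟩
                  rcases Finset.mem_insert.1 hz with rfl | hz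
                  · exact hvx hzx
                  · exact hxN ⟨z, hz, hzx⟩
                unfold roundWeight
                rw [if_neg h1, if_neg h2]
          · have h1 : ¬ (x ∈ W ∧ ∃ z ∈ Z, G.Adj z x) := fun h => hxW h.1
            have h2 : ¬ (x ∈ W ∧ ∃ z ∈ insert v Z, G.Adj z x) := fun h => hxW h.1
            rw [if_neg (fun h => hxW (mem_alive.1 h.1).1)]
            unfold roundWeight
            rw [if_neg h1, if_neg h2]
        rw [hweq]
        have hsub : alive G W (insert v Z) ⊆ (alive G W Z).erase v := by
          intro x hx
          rw [mem_alive] at hx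
          rw [Finset.mem_erase, mem_alive]
          refine ⟨fun h => hx.2.1 (h ▸ Finset.mem_insert_self _ _), hx.1,
            fun h => hx.2.1 (Finset.mem_insert_of_mem h),
            fun z hz => hx.2.2 z (Finset.mem_insert_of_mem hz)⟩
        rw [coverSet_congr hsub]
        · exact hfreeze
        -- Edges at a new neighbor of `v` are settled: one end has weight `k - l` and the other at
        -- least `l`.
        · intro i hi j hj hij hi'
          rw [Finset.mem_erase, mem_alive] at hi hj
          have hvi : G.Adj v i := by
            by_contra hvi
            refine hi' (mem_alive.2 ⟨hi.2.1, fun h => ?_, fun z hz => ?_⟩)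
            · rcases Finset.mem_insert.1 h with h | h
              · exact hi.1 h
              · exact hi.2.2.1 h
            · rcases Finset.mem_insert.1 hz with rfl | hz
              · exact hvi
              · exact hi.2.2.2 z hz
          have := hge j hj.2.1
          have e : roundWeight G W k l w (insert v Z) R i = k - l := by
            unfold roundWeight
            rw [if_pos ⟨hi.2.1, v, Finset.mem_insert_self _ _, hvi⟩]
          omega

/-- Induction on `t = k - 2l` in steps of two, one round per step. The number `c` bounds `|W| - |A|`
over the independent dominating sets `A` of `W`, that is, the minimal vertex covers of the graph on
`W`. The last hypothesis is the quantity that never increases from round to round; `∑ w ≤ r` is what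
remains to be known once `t = 0` or `W` is empty. -/
theorem ClawFree.regLE_coverSet [Fintype V] [DecidableEq V] (hG : ClawFree G) (k t : ℕ) :
    ∀ (l : ℕ) (_ : 2 * l + t = k) (W : Finset V) (w : V → ℕ) (c r : ℕ)
    (_ : ∀ x ∈ W, w x = l) (_ : ∀ x ∈ W, ∃ y ∈ W, G.Adj x y)
    (_ : ∀ A, Dominates G W A → Independent G A → W.card ≤ c + A.card)
    (_ : ∑ x, w x ≤ r)
    (_ : t ≠ 0 → W.Nonempty → ∑ x, w x + (t - 1) * c + W.card ≤ r + 1),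
    RegLE K (coverSet G k W w) r := by
  classical
  induction t using Nat.twoStepInduction with
  | zero =>
    intro l hl W w c r hw _ _ hr _
    refine regLE_coverSet_of_le (fun i hi j hj _ => ?_) hr
    rw [hw i hi, hw j hj]; omega
  | one =>
    intro l hl W w c r hw _ _ hr hr'
    rcases W.eq_empty_or_nonempty with rfl | hW
    · exact regLE_coverSet_of_le (fun i hi => absurd hi (Finset.notMem_empty i)) hr
    obtain ⟨v₀, hv₀⟩ := hW
    have hr'' := hr' one_ne_zero ⟨v₀, hv₀⟩
    have hstart : coverSet G k W w =
        coverSet G k (alive G W ∅) (roundWeight G W k l w ∅ ∅) := by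
      congr 1
      · ext x; simp [mem_alive]
      · funext x; simp [roundWeight]
    rw [hstart]
    -- In the last round of the odd case one vertex `v₀` is left unprocessed: with every other
    -- living vertex at `l + 1`, edges already have sum at least `2l + 1 = k`. This saves the final
    -- `1` in the bound.
    refine regLE_round (by omega) (T₀ := W.erase v₀) (Finset.erase_subset _ _) hw ?_
      (W.erase v₀) ∅ ∅ (by simp) (by simp) (by simp) (fun x hx => by simp at hx)
    intro Z R hZR hdis hind
    have hZW : ∀ x ∈ Z, x ∈ W := fun x hx => (Finset.mem_erase.1
      (hZR ▸ Finset.mem_union_left _ hx : x ∈ W.erase v₀)).2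
    have hRW : ∀ x ∈ R, x ∈ W.erase v₀ := fun x hx => hZR ▸ Finset.mem_union_right _ hx
    refine regLE_coverSet_of_le (fun i hi j hj hij => ?_) ?_
    · have hge : ∀ x ∈ alive G W Z, l ≤ roundWeight G W k l w Z R x ∧
          (x ≠ v₀ → l + 1 ≤ roundWeight G W k l w Z R x) := by
        intro x hx
        rw [mem_alive] at hx
        unfold roundWeight
        rw [if_neg (by rintro ⟨-, z, hz, hzx⟩; exact hx.2.2 z hz hzx)]
        split_ifs with hxR
        · exact ⟨Nat.le_succ l, fun _ => le_rfl⟩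
        · refine ⟨(hw x hx.1).ge, fun hxv => absurd ?_ hxR⟩
          have : x ∈ Z ∪ R := hZR ▸ Finset.mem_erase.2 ⟨hxv, hx.1⟩
          exact (Finset.mem_union.1 this).resolve_left hx.2.1
      have h1 := hge i hi
      have h2 := hge j hj
      by_cases hiv : i = v₀
      · have := h2.2 (fun h => hij.ne (hiv.trans h.symm))
        omega
      · have := h1.2 hiv
        omega
    · obtain ⟨x₀, hx₀W, hx₀⟩ : ∃ x₀ ∈ W, roundWeight G W k l w Z R x₀ = w x₀ := by
        rcases Z.eq_empty_or_nonempty with rfl | ⟨z, hz⟩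
        · refine ⟨v₀, hv₀, ?_⟩
          unfold roundWeight
          rw [if_neg (by simp), if_neg (fun h => (Finset.mem_erase.1 (hRW _ h)).1 rfl)]
        · refine ⟨z, hZW z hz, ?_⟩
          unfold roundWeight
          rw [if_neg (by rintro ⟨-, z', hz', h⟩; exact hind z' hz' z hz h),
            if_neg (Finset.disjoint_left.1 hdis hz)]
      have hle : ∀ x, roundWeight G W k l w Z R x ≤ w x + if x ∈ W.erase x₀ then 1 else 0 := by
        intro x
        by_cases hx : x ∈ W.erase x₀
        · rw [if_pos hx]
          have := hw x (Finset.mem_of_mem_erase hx)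
          unfold roundWeight
          split_ifs <;> omega
        · rw [if_neg hx, add_zero]
          by_cases hxx : x = x₀
          · rw [hxx, hx₀]
          · have hxW : x ∉ W := fun h => hx (Finset.mem_erase.2 ⟨hxx, h⟩)
            unfold roundWeight
            rw [if_neg (fun h => hxW h.1),
              if_neg (fun h => hxW (Finset.mem_of_mem_erase (hRW x h)))]
      refine (Finset.sum_le_sum fun x _ => hle x).trans ?_
      rw [Finset.sum_add_distrib, Finset.sum_ite_mem, Finset.univ_inter, Finset.sum_const,
        smul_eq_mul, mul_one, Finset.card_erase_of_mem hx₀W]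
      have : 0 < W.card := Finset.card_pos.2 ⟨v₀, hv₀⟩
      omega
  | more t ih _ =>
    intro l hl W w c r hw hiso hc hr hr'
    rcases W.eq_empty_or_nonempty with rfl | hW
    · exact regLE_coverSet_of_le (fun i hi => absurd hi (Finset.notMem_empty i)) hr
    have hr'' := hr' (by omega) hW
    have hstart : coverSet G k W w =
        coverSet G k (alive G W ∅) (roundWeight G W k l w ∅ ∅) := by
      congr 1
      · ext x; simp [mem_alive]
      · funext x; simp [roundWeight]
    rw [hstart]
    refine regLE_round (by omega) (T₀ := W) subset_rfl hw ?_
      W ∅ ∅ (by simp) (by simp) (by simp) (fun x hx => by simp at hx)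
    intro Z R hZR hdis hind
    have hZW : ∀ x ∈ Z, x ∈ W := fun x hx => hZR ▸ Finset.mem_union_left _ hx
    have hRW : ∀ x ∈ R, x ∈ W := fun x hx => hZR ▸ Finset.mem_union_right _ hx
    have hnotN : ∀ x ∈ Z, ¬ ∃ z ∈ Z, G.Adj z x := by
      rintro x hx ⟨z, hz, h⟩
      exact hind z hz x hx h
    set H := alive G W Z with hH
    let N : Finset V := W.filter fun x => ∃ z ∈ Z, G.Adj z x
    have hN : ∀ x, x ∈ N ↔ x ∈ W ∧ ∃ z ∈ Z, G.Adj z x := fun x => Finset.mem_filter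
    let H' : Finset V := H.filter fun x => ∃ y ∈ H, G.Adj x y
    have hH' : ∀ x, x ∈ H' ↔ x ∈ H ∧ ∃ y ∈ H, G.Adj x y := fun x => Finset.mem_filter
    have hHmem : ∀ x, x ∈ H ↔ x ∈ W ∧ x ∉ Z ∧ ¬ ∃ z ∈ Z, G.Adj z x := by
      intro x
      rw [hH, mem_alive]
      push Not
      rfl
    have hcard : W.card = Z.card + N.card + H.card := by
      have e : W = (Z ∪ N) ∪ H := by
        ext x
        rw [Finset.mem_union, Finset.mem_union, hN, hHmem]
        have := hZW x
        generalize (∃ z ∈ Z, G.Adj z x) = P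
        tauto
      have d1 : Disjoint Z N := Finset.disjoint_left.2 fun x hx h => hnotN x hx ((hN x).1 h).2
      have d2 : Disjoint (Z ∪ N) H := by
        refine Finset.disjoint_left.2 fun x hx h => ?_
        rw [hHmem] at h
        rcases Finset.mem_union.1 hx with hx | hx
        · exact h.2.1 hx
        · exact h.2.2 ((hN x).1 hx).2
      conv_lhs => rw [e]
      rw [Finset.card_union_of_disjoint d2, Finset.card_union_of_disjoint d1]
    -- Frozen vertices stay at `l`, vertices of `N` rise by `k - 2l = t + 2`, and living vertices
    -- rise by `1`.
    have hsum : ∑ x, roundWeight G W k l w Z R x = ∑ x, w x + (t + 2) * N.card + H.card := by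
      have hpt : ∀ x, roundWeight G W k l w Z R x =
          w x + (if x ∈ N then t + 2 else 0) + if x ∈ H then 1 else 0 := by
        intro x
        by_cases hxN : x ∈ N
        · have h1 : x ∉ H := fun h => ((hHmem x).1 h).2.2 ((hN x).1 hxN).2
          rw [if_pos hxN, if_neg h1, hw x ((hN x).1 hxN).1]
          unfold roundWeight
          rw [if_pos ((hN x).1 hxN)]
          omega
        · rw [if_neg hxN]
          unfold roundWeight
          rw [if_neg (fun h => hxN ((hN x).2 h))]
          by_cases hxR : x ∈ R
          · have hxW := hRW x hxR
            rw [if_pos hxR, if_pos ((hHmem x).2 ⟨hxW, Finset.disjoint_right.1 hdis hxR,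
              fun h => hxN ((hN x).2 ⟨hxW, h⟩)⟩), hw x hxW]
          · have hxH : x ∉ H := by
              rw [hHmem]
              rintro ⟨hxW, hxZ, -⟩
              rw [← hZR, Finset.mem_union] at hxW
              tauto
            rw [if_neg hxR, if_neg hxH, add_zero, add_zero]
      rw [Finset.sum_congr rfl fun x _ => hpt x, Finset.sum_add_distrib, Finset.sum_add_distrib,
        Finset.sum_ite_mem, Finset.sum_ite_mem, Finset.univ_inter, Finset.univ_inter,
        Finset.sum_const, Finset.sum_const, smul_eq_mul, smul_eq_mul, mul_one, mul_comm N.card]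
    have hiso' : ∀ x ∈ H', ∃ y ∈ H', G.Adj x y := by
      intro x hx
      obtain ⟨hxH, y, hy, hxy⟩ := (hH' x).1 hx
      exact ⟨y, (hH' y).2 ⟨hy, x, hxH, hxy.symm⟩, hxy⟩
    obtain ⟨A, hA1, hA2, hA3, hA4⟩ := hG.exists_min_independent_dominates H' hiso'
    have hAH : ∀ x ∈ A, x ∈ H := fun x hx => ((hH' x).1 (hA1.1 hx)).1
    have hnoH : ∀ x ∈ H \ H', ∀ y ∈ H, ¬ G.Adj x y := by
      intro x hx y hy hxy
      rw [Finset.mem_sdiff] at hx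
      exact hx.2 ((hH' x).2 ⟨hx.1, y, hy, hxy⟩)
    have hZH : ∀ z ∈ Z, ∀ y ∈ H, ¬ G.Adj z y := fun z hz y hy h => ((hHmem y).1 hy).2.2 ⟨z, hz, h⟩
    -- The smallest independent dominating set of `H'`, the isolated vertices of `H` and the frozen
    -- vertices together form an independent dominating set of `W`. Comparing sizes gives `hcc`.
    have hAZ := hc (A ∪ (H \ H') ∪ Z) (by
      refine ⟨fun x hx => ?_, fun x hx hxA => ?_⟩
      · rw [Finset.mem_union, Finset.mem_union] at hx
        rcases hx with (hx | hx) | hx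
        · exact ((hHmem x).1 (hAH x hx)).1
        · exact ((hHmem x).1 (Finset.mem_sdiff.1 hx).1).1
        · exact hZW x hx
      · simp only [Finset.mem_union, not_or, Finset.mem_sdiff, not_and, not_not] at hxA
        by_cases hxN : ∃ z ∈ Z, G.Adj z x
        · obtain ⟨z, hz, hzx⟩ := hxN
          exact ⟨z, Finset.mem_union_right _ hz, hzx.symm⟩
        · obtain ⟨y, hy, hxy⟩ := hA1.2 x (hxA.1.2 ((hHmem x).2 ⟨hx, hxA.2, hxN⟩)) hxA.1.1
          exact ⟨y, Finset.mem_union_left _ (Finset.mem_union_left _ hy), hxy⟩) (by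
      have hB : ∀ x ∈ A ∪ (H \ H'), ∀ y ∈ A ∪ (H \ H'), ¬ G.Adj x y := by
        have hAH' : ∀ x ∈ A ∪ (H \ H'), x ∈ H := by
          intro x hx
          rcases Finset.mem_union.1 hx with hx | hx
          · exact hAH x hx
          · exact (Finset.mem_sdiff.1 hx).1
        intro x hx y hy hxy
        rcases Finset.mem_union.1 hx with hx' | hx'
        · rcases Finset.mem_union.1 hy with hy' | hy'
          · exact hA2 x hx' y hy' hxy
          · exact hnoH y hy' x (hAH' x hx) hxy.symm
        · exact hnoH x hx' y (hAH' y hy) hxy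
      have hBH : ∀ x ∈ A ∪ (H \ H'), x ∈ H := by
        intro x hx
        rcases Finset.mem_union.1 hx with hx | hx
        · exact hAH x hx
        · exact (Finset.mem_sdiff.1 hx).1
      intro x hx y hy hxy
      rcases Finset.mem_union.1 hx with hx | hx <;> rcases Finset.mem_union.1 hy with hy | hy
      · exact hB x hx y hy hxy
      · exact hZH y hy x (hBH x hx) hxy.symm
      · exact hZH x hx y (hBH y hy) hxy
      · exact hind x hx y hy hxy)
    have hAc : (A ∪ (H \ H') ∪ Z).card ≤ A.card + (H.card - H'.card) + Z.card := by
      refine (Finset.card_union_le _ _).trans (Nat.add_le_add_right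
        ((Finset.card_union_le _ _).trans (Nat.add_le_add_left ?_ _)) _)
      rw [Finset.card_sdiff_of_subset (Finset.filter_subset _ _)]
    have hH'le : H'.card ≤ H.card := Finset.card_filter_le _ _
    have hcc : N.card + (H'.card - A.card) ≤ c := by omega
    have hmul := Nat.mul_le_mul_left (t + 1) hcc
    rw [coverSet_congr (Y := H') (Finset.filter_subset _ _) (fun i hi j hj hij hi' =>
      absurd ((hH' i).2 ⟨hi, j, hj, hij⟩) hi')]
    have ht1 : t + 2 - 1 = t + 1 := by omega
    rw [ht1] at hr''
    -- Since `A` is smallest possible, `|H'| - |A|` is a valid cover bound on `H'`.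
    refine ih (l + 1) (by omega) H' _ (H'.card - A.card) r ?_ hiso' ?_ ?_ ?_
    · intro x hx
      have hxH := ((hH' x).1 hx).1
      have h := (hHmem x).1 hxH
      unfold roundWeight
      rw [if_neg (fun h' => h.2.2 h'.2), if_pos]
      have := h.1
      rw [← hZR, Finset.mem_union] at this
      exact this.resolve_left h.2.1
    · intro B hB1 hB2
      have := hA4 B hB1 hB2
      have : A.card ≤ H'.card := Finset.card_le_card hA1.1
      omega
    · rw [hsum]
      -- This absorbs the `1` in `r + 1`. If nothing is frozen, then `H' = W` is nonempty and `2|A|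
      -- ≤ |W|` leaves `|W| - |A| ≥ 1`.
      have hpos : 1 ≤ Z.card + (t + 1) * (H'.card - A.card) := by
        rcases Z.eq_empty_or_nonempty with hZ | hZ
        · have hHW : H' = W := by
            have : H = W := by
              ext x; rw [hHmem, hZ]; simp
            ext x
            rw [hH', this]
            exact ⟨fun h => h.1, fun h => ⟨h, hiso x h⟩⟩
          have h1 : 1 ≤ W.card := Finset.card_pos.2 hW
          rw [hHW] at hA3 ⊢
          have h2 : 1 ≤ W.card - A.card := by omega
          have := Nat.mul_le_mul (Nat.le_add_left 1 t) h2
          omega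
        · have : 1 ≤ Z.card := Finset.card_pos.2 hZ
          omega
      nlinarith
    · intro ht0 _
      rw [hsum]
      obtain ⟨s, rfl⟩ := Nat.exists_eq_succ_of_ne_zero ht0
      -- The half bound from claw-freeness is exactly what keeps the quantity from increasing.
      have h2 : H'.card ≤ 2 * (H'.card - A.card) := by omega
      simp only [Nat.succ_eq_add_one, Nat.add_sub_cancel] at *
      nlinarith

end Game

/-! ### Symbolic powers of the cover ideal and their generators. -/

section Symbolic

variable {V : Type u} {K : Type v} [Field K]

/-- The exponents whose values at `i` and `j` sum to at least `k`. -/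
def edgeSet (i j : V) (k : ℕ) : UpperSet (V →₀ ℕ) where
  carrier := {m | k ≤ m i + m j}
  upper' := fun _ _ h hm => le_trans hm (add_le_add (h i) (h j))

theorem mem_edgeSet {i j : V} {k : ℕ} {m : V →₀ ℕ} : m ∈ edgeSet i j k ↔ k ≤ m i + m j := Iff.rfl

open Classical in
/-- The substitution that multiplies the variables `i` and `j` by a new variable. -/
noncomputable def rescale (K : Type v) [Field K] (i j : V) :
    MvPolynomial V K →ₐ[K] Polynomial (MvPolynomial V K) :=
  MvPolynomial.aeval fun l =>
    if l = i ∨ l = j then Polynomial.X * Polynomial.C (MvPolynomial.X l)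
    else Polynomial.C (MvPolynomial.X l)

theorem rescale_monomial {i j : V} (hij : i ≠ j) (m : V →₀ ℕ) (c : K) :
    rescale K i j (MvPolynomial.monomial m c) =
      Polynomial.monomial (m i + m j) (MvPolynomial.monomial m c) := by
  classical
  induction m using Finsupp.induction_linear generalizing c with
  | zero =>
    rw [← MvPolynomial.C_apply, rescale, MvPolynomial.aeval_C]
    rfl
  | add m m' hm hm' =>
    have h : MvPolynomial.monomial (m + m') c =
        MvPolynomial.monomial m c * MvPolynomial.monomial m' (1 : K) := by
      rw [MvPolynomial.monomial_mul, mul_one]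
    rw [h, map_mul, hm, hm', Polynomial.monomial_mul_monomial, Finsupp.add_apply,
      Finsupp.add_apply, add_add_add_comm (m i)]
  | single l n =>
    rw [← MvPolynomial.C_mul_X_pow_eq_monomial, map_mul, map_pow, rescale, MvPolynomial.aeval_X,
      MvPolynomial.aeval_C]
    have hC : algebraMap K (Polynomial (MvPolynomial V K)) c =
      Polynomial.C (MvPolynomial.C c) := rfl
    rw [hC]
    by_cases hl : l = i ∨ l = j
    · have hn : (Finsupp.single l n) i + (Finsupp.single l n) j = n := by
        rcases hl with rfl | rfl
        · simp [hij]
        · simp [hij.symm]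
      rw [if_pos hl, hn, mul_pow, ← Polynomial.C_mul_X_pow_eq_monomial, map_mul, map_pow]
      ring
    · have hn : (Finsupp.single l n) i + (Finsupp.single l n) j = 0 := by
        rw [not_or] at hl
        simp [hl]
      rw [if_neg hl, hn, Polynomial.monomial_zero_left, map_mul, map_pow]

theorem coeff_coeff_rescale {i j : V} (hij : i ≠ j) (f : MvPolynomial V K) (d : ℕ) (m : V →₀ ℕ) :
    MvPolynomial.coeff m ((rescale K i j f).coeff d) =
      if m i + m j = d then MvPolynomial.coeff m f else 0 := by
  classical
  induction f using MvPolynomial.induction_on' with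
  | monomial a c =>
    rw [rescale_monomial hij, Polynomial.coeff_monomial]
    split_ifs with h1 h2 h2
    · rfl
    · rw [MvPolynomial.coeff_monomial, if_neg]
      rintro rfl
      exact h2 h1
    · rw [MvPolynomial.coeff_monomial, if_neg, MvPolynomial.coeff_zero]
      rintro rfl
      exact h1 h2
    · exact MvPolynomial.coeff_zero _
  | add p q hp hq =>
    rw [map_add, Polynomial.coeff_add, MvPolynomial.coeff_add, hp, hq, MvPolynomial.coeff_add]
    split_ifs <;> simp

/-- The exponent of the new variable records `m i + m j`. Primality of `(x_i, x_j)` and primariness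
of its powers thereby reduce to the primality of one polynomial variable. -/
theorem mem_monoIdeal_edgeSet {i j : V} (hij : i ≠ j) {k : ℕ} {f : MvPolynomial V K} :
    f ∈ monoIdeal K (edgeSet i j k) ↔ Polynomial.X ^ k ∣ rescale K i j f := by
  rw [Polynomial.X_pow_dvd_iff, mem_monoIdeal]
  constructor
  · intro h d hd
    ext m
    rw [coeff_coeff_rescale hij, MvPolynomial.coeff_zero]
    split_ifs with hm
    · by_contra hne
      have := mem_edgeSet.1 (h m (MvPolynomial.mem_support_iff.2 hne))
      omega
    · rfl
  · intro h m hm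
    by_contra hlt
    rw [mem_edgeSet, not_le] at hlt
    have := coeff_coeff_rescale hij f (m i + m j) m
    rw [h _ hlt, if_pos rfl, MvPolynomial.coeff_zero] at this
    exact MvPolynomial.mem_support_iff.1 hm this.symm

theorem isPrime_monoIdeal_edgeSet {i j : V} (hij : i ≠ j) :
    (monoIdeal K (edgeSet i j 1)).IsPrime := by
  have hX : Prime (Polynomial.X : Polynomial (MvPolynomial V K)) := Polynomial.prime_X
  constructor
  · rw [Ne, Ideal.eq_top_iff_one, mem_monoIdeal_edgeSet hij, pow_one, map_one]
    exact hX.not_dvd_one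
  · intro f g h
    rw [mem_monoIdeal_edgeSet hij, pow_one, map_mul] at h
    rw [mem_monoIdeal_edgeSet hij, mem_monoIdeal_edgeSet hij, pow_one]
    exact hX.dvd_or_dvd h

theorem mem_monoIdeal_edgeSet_of_mul_mem {i j : V} (hij : i ≠ j) {k : ℕ} {s f : MvPolynomial V K}
    (hs : s ∉ monoIdeal K (edgeSet i j 1)) (h : s * f ∈ monoIdeal K (edgeSet i j k)) :
    f ∈ monoIdeal K (edgeSet i j k) := by
  rw [mem_monoIdeal_edgeSet hij, pow_one] at hs
  rw [mem_monoIdeal_edgeSet hij, map_mul] at h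
  rw [mem_monoIdeal_edgeSet hij]
  exact Polynomial.prime_X.pow_dvd_of_dvd_mul_left _ hs h

theorem pow_monoIdeal_edgeSet_le (i j : V) (k : ℕ) :
    monoIdeal K (edgeSet i j 1) ^ k ≤ monoIdeal K (edgeSet i j k) := by
  classical
  induction k with
  | zero => intro f _ m _; exact Nat.zero_le _
  | succ k ih =>
    rw [pow_succ, Ideal.mul_le]
    intro f hf g hg m hm
    obtain ⟨a, ha, b, hb, rfl⟩ := Finset.mem_add.1 (MvPolynomial.support_mul _ _ hm)
    have h1 := mem_edgeSet.1 (ih hf a ha)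
    have h2 := mem_edgeSet.1 (hg b hb)
    rw [mem_edgeSet, Finsupp.add_apply, Finsupp.add_apply]
    omega

theorem prod_X_eq_monomial (C : Finset V) :
    (∏ x ∈ C, MvPolynomial.X x : MvPolynomial V K) =
      MvPolynomial.monomial (∑ x ∈ C, Finsupp.single x 1) 1 := by
  rw [MvPolynomial.monomial_sum_one]
  rfl

theorem sum_single_apply [DecidableEq V] (C : Finset V) (y : V) :
    (∑ x ∈ C, Finsupp.single x 1 : V →₀ ℕ) y = if y ∈ C then 1 else 0 := by
  rw [Finsupp.finsetSum_apply]
  simp [Finsupp.single_apply]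

theorem X_mem_monoIdeal_edgeSet {i j l : V} :
    (MvPolynomial.X l : MvPolynomial V K) ∈ monoIdeal K (edgeSet i j 1) ↔ l = i ∨ l = j := by
  classical
  rw [MvPolynomial.X, monomial_mem_monoIdeal, mem_edgeSet, Finsupp.single_apply,
    Finsupp.single_apply]
  split_ifs <;> simp_all

variable {G : SimpleGraph V}

theorem coverIdeal_le {i j : V} (hij : G.Adj i j) :
    coverIdeal K G ≤ monoIdeal K (edgeSet i j 1) := by
  classical
  refine Ideal.span_le.2 ?_
  rintro _ ⟨C, hC, rfl⟩
  rw [SetLike.mem_coe, prod_X_eq_monomial, monomial_mem_monoIdeal, mem_edgeSet, sum_single_apply,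
    sum_single_apply]
  rcases hC.1 hij with h | h
  · rw [if_pos (Finset.mem_coe.1 h)]; omega
  · rw [if_pos (Finset.mem_coe.1 h)]; omega

theorem monoIdeal_edgeSet_le {i j : V} {p : Ideal (MvPolynomial V K)}
    (hi : MvPolynomial.X i ∈ p) (hj : MvPolynomial.X j ∈ p) :
    monoIdeal K (edgeSet i j 1) ≤ p := by
  classical
  intro f hf
  rw [f.as_sum]
  refine Ideal.sum_mem _ fun m hm => ?_
  have := mem_edgeSet.1 (hf m hm)
  obtain ⟨l, hl, hlm⟩ : ∃ l, MvPolynomial.X l ∈ p ∧ m l ≠ 0 := by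
    by_cases h : m i = 0
    · exact ⟨j, hj, by omega⟩
    · exact ⟨i, hi, h⟩
  refine Ideal.mem_of_dvd _ ?_ hl
  rw [MvPolynomial.X_dvd_monomial]
  exact Or.inr hlm

theorem mem_symbolicPower {R : Type*} [CommRing R] {I : Ideal R} {k : ℕ} {f : R} :
    f ∈ symbolicPower I k ↔ ∀ p ∈ I.minimalPrimes, ∃ s, s ∉ p ∧ s * f ∈ I ^ k := by
  rw [symbolicPower, Submodule.mem_iInf, Subtype.forall]
  refine forall_congr' fun p => forall_congr' fun hp => ?_
  have : p.IsPrime := hp.1.1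
  rw [LinearMap.mem_ker, LinearMap.comp_apply, 
    IsLocalizedModule.eq_zero_iff p.primeCompl]
  constructor
  · rintro ⟨s, hs⟩
    refine ⟨s, s.2, ?_⟩
    have : (Submodule.mkQ (I ^ k)) ((s : R) • f) = 0 := by rw [map_smul]; exact hs
    rwa [Submodule.mkQ_apply, Submodule.Quotient.mk_eq_zero] at this
  · rintro ⟨s, hs, h⟩
    refine ⟨⟨s, hs⟩, ?_⟩
    have : (Submodule.mkQ (I ^ k)) (s • f) = 0 := by
      rwa [Submodule.mkQ_apply, Submodule.Quotient.mk_eq_zero]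
    rw [map_smul] at this
    exact this

theorem isVertexCover_of_monomial_mem {a : V →₀ ℕ}
    (ha : MvPolynomial.monomial a (1 : K) ∈ coverIdeal K G) :
    G.IsVertexCover (a.support : Set V) := by
  intro i j hij
  have := mem_edgeSet.1 (monomial_mem_monoIdeal.1 (coverIdeal_le hij ha))
  rw [Finset.mem_coe, Finset.mem_coe, Finsupp.mem_support_iff, Finsupp.mem_support_iff]
  omega

theorem degree_sum_single (C : Finset V) :
    (∑ x ∈ C, Finsupp.single x 1 : V →₀ ℕ).degree = C.card := by
  rw [map_sum]
  simp

variable [Fintype V]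

theorem exists_minimal_cover_subset {D : Set V} (hD : G.IsVertexCover D) :
    ∃ C : Finset V, (C : Set V) ⊆ D ∧ Minimal G.IsVertexCover (C : Set V) := by
  classical
  obtain ⟨C, hCD, hC⟩ := exists_minimal_le_of_wellFoundedLT G.IsVertexCover D hD
  exact ⟨C.toFinset, by simpa using hCD, by simpa using hC⟩

theorem prod_X_mem_coverIdeal {D : Finset V} (hD : G.IsVertexCover (D : Set V)) :
    (∏ x ∈ D, MvPolynomial.X x : MvPolynomial V K) ∈ coverIdeal K G := by
  obtain ⟨C, hCD, hC⟩ := exists_minimal_cover_subset hD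
  refine Ideal.mem_of_dvd _ (Finset.prod_dvd_prod_of_subset C D _ (Finset.coe_subset.1 hCD)) ?_
  exact Ideal.subset_span ⟨C, hC, rfl⟩

theorem exists_adj_of_coverIdeal_le {p : Ideal (MvPolynomial V K)} [hp : p.IsPrime]
    (h : coverIdeal K G ≤ p) :
    ∃ i j, G.Adj i j ∧ MvPolynomial.X i ∈ p ∧ MvPolynomial.X j ∈ p := by
  classical
  by_contra! hne
  have hD : G.IsVertexCover
      ((Finset.univ.filter fun l => (MvPolynomial.X l : MvPolynomial V K) ∉ p : Finset V) :
        Set V) := by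
    intro i j hij
    simp only [Finset.coe_filter, Finset.mem_univ, true_and, Set.mem_ofPred_eq]
    by_cases hi : (MvPolynomial.X i : MvPolynomial V K) ∈ p
    · exact Or.inr (hne i j hij hi)
    · exact Or.inl hi
  obtain ⟨x, hx, hxp⟩ := (Ideal.IsPrime.prod_mem_iff).1 (h (prod_X_mem_coverIdeal hD))
  exact (Finset.mem_filter.1 hx).2 hxp

/-- A prime over `J` contains both variables of some edge, since otherwise the vertices whose
variables lie outside it would form a cover with product in the prime. No edge ideal `(x_i, x_j)`
properly contains another. -/
theorem mem_minimalPrimes_coverIdeal_iff {p : Ideal (MvPolynomial V K)} :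
    p ∈ (coverIdeal K G).minimalPrimes ↔
      ∃ i j, G.Adj i j ∧ p = monoIdeal K (edgeSet i j 1) := by
  constructor
  · intro hp
    have := hp.1.1
    obtain ⟨i, j, hij, hi, hj⟩ := exists_adj_of_coverIdeal_le hp.1.2
    have hle := monoIdeal_edgeSet_le hi hj
    exact ⟨i, j, hij, le_antisymm
      (hp.2 ⟨isPrime_monoIdeal_edgeSet hij.ne, coverIdeal_le hij⟩ hle) hle⟩
  · rintro ⟨i, j, hij, rfl⟩
    refine ⟨⟨isPrime_monoIdeal_edgeSet hij.ne, coverIdeal_le hij⟩, fun q hq hle => ?_⟩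
    have := hq.1
    obtain ⟨a, b, hab, ha, hb⟩ := exists_adj_of_coverIdeal_le hq.2
    have ha' := X_mem_monoIdeal_edgeSet.1 (hle ha)
    have hb' := X_mem_monoIdeal_edgeSet.1 (hle hb)
    have hne := hab.ne
    rcases ha' with rfl | rfl <;> rcases hb' with rfl | rfl
    · exact absurd rfl hne
    · exact monoIdeal_edgeSet_le ha hb
    · exact monoIdeal_edgeSet_le hb ha
    · exact absurd rfl hne

/-- The product `s` of the variables other than `x_i`, `x_j` is a unit at the prime `(x_i, x_j)`,
and `x_i s`, `x_j s` lie in `J` because the complement of a single vertex is a cover. So `J` and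
`(x_i, x_j)` agree locally. -/
theorem mul_monomial_mem_coverIdeal_pow [DecidableEq V] {i j : V} (hij : i ≠ j) {k : ℕ}
    {m : V →₀ ℕ} (hm : k ≤ m i + m j) (c : K) :
    (∏ l ∈ (Finset.univ.erase i).erase j, MvPolynomial.X l) ^ k * MvPolynomial.monomial m c ∈
      coverIdeal K G ^ k := by
  set s : MvPolynomial V K := ∏ l ∈ (Finset.univ.erase i).erase j, MvPolynomial.X l with hs
  have hcov : ∀ l : V, G.IsVertexCover ((Finset.univ.erase l : Finset V) : Set V) := by
    intro l a b hab
    by_cases ha : a = l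
    · right
      simp only [Finset.coe_erase, Finset.coe_univ, Set.mem_sdiff, Set.mem_univ,
        Set.mem_singleton_iff, true_and]
      rintro rfl
      exact hab.ne ha
    · left
      simpa using ha
  have hsj : MvPolynomial.X j * s ∈ coverIdeal K G := by
    rw [hs, Finset.mul_prod_erase _ _ (Finset.mem_erase.2 ⟨hij.symm, Finset.mem_univ j⟩)]
    exact prod_X_mem_coverIdeal (hcov i)
  have hsi : MvPolynomial.X i * s ∈ coverIdeal K G := by
    rw [hs, Finset.erase_right_comm,
      Finset.mul_prod_erase _ _ (Finset.mem_erase.2 ⟨hij, Finset.mem_univ i⟩)]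
    exact prod_X_mem_coverIdeal (hcov j)
  -- The `k` factors of `s` are distributed over `a` copies of `x_i` and `b` copies of `x_j`
  -- dividing the monomial.
  obtain ⟨a, b, ha, hb, rfl⟩ : ∃ a b, a ≤ m i ∧ b ≤ m j ∧ a + b = k :=
    ⟨min k (m i), k - min k (m i), min_le_right _ _, by omega, by omega⟩
  have hle : Finsupp.single i a + Finsupp.single j b ≤ m := by
    intro l
    rw [Finsupp.add_apply, Finsupp.single_apply, Finsupp.single_apply]
    split_ifs with h1 h2 h2
    · exact absurd (h1.trans h2.symm) hij
    · rw [← h1]; omega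
    · rw [← h2]; omega
    · exact Nat.zero_le _
  have hmon : MvPolynomial.monomial m c = MvPolynomial.X i ^ a * MvPolynomial.X j ^ b *
      MvPolynomial.monomial (m - (Finsupp.single i a + Finsupp.single j b)) c := by
    rw [MvPolynomial.X_pow_eq_monomial, MvPolynomial.X_pow_eq_monomial,
      MvPolynomial.monomial_mul, MvPolynomial.monomial_mul, add_tsub_cancel_of_le hle]
    simp
  have e : s ^ (a + b) * MvPolynomial.monomial m c =
      MvPolynomial.monomial (m - (Finsupp.single i a + Finsupp.single j b)) c *
        ((MvPolynomial.X i * s) ^ a * (MvPolynomial.X j * s) ^ b) := by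
    rw [hmon]; ring
  rw [e, pow_add (coverIdeal K G)]
  exact Ideal.mul_mem_left _ _ (Ideal.mul_mem_mul (Ideal.pow_mem_pow hsi a)
    (Ideal.pow_mem_pow hsj b))

/-- The symbolic powers of the cover ideal are monomial ideals. -/
theorem symbolicPower_coverIdeal (k : ℕ) :
    symbolicPower (coverIdeal K G) k = monoIdeal K (coverSet G k Finset.univ 0) := by
  classical
  ext f
  rw [mem_symbolicPower]
  constructor
  · intro h m hm
    refine ⟨fun _ => Nat.zero_le _, fun i _ j _ hij => ?_⟩
    obtain ⟨s, hs, hsf⟩ := h _ (mem_minimalPrimes_coverIdeal_iff.2 ⟨i, j, hij, rfl⟩)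
    exact mem_monoIdeal_edgeSet_of_mul_mem hij.ne hs
      (pow_monoIdeal_edgeSet_le i j k (Ideal.pow_right_mono (coverIdeal_le hij) k hsf)) m hm
  · intro hf p hp
    obtain ⟨i, j, hij, rfl⟩ := mem_minimalPrimes_coverIdeal_iff.1 hp
    have := isPrime_monoIdeal_edgeSet (K := K) hij.ne
    refine ⟨(∏ l ∈ (Finset.univ.erase i).erase j, MvPolynomial.X l) ^ k, fun h => ?_, ?_⟩
    · obtain ⟨l, hl, hl'⟩ := (Ideal.IsPrime.prod_mem_iff).1
        (Ideal.IsPrime.mem_of_pow_mem this k h)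
      rcases X_mem_monoIdeal_edgeSet.1 hl' with rfl | rfl <;> simp at hl
    · rw [f.as_sum, Finset.mul_sum]
      exact Ideal.sum_mem _ fun m hm => mul_monomial_mem_coverIdeal_pow hij.ne
        ((hf m hm).2 i (Finset.mem_univ _) j (Finset.mem_univ _) hij) _

theorem mem_minimalMonomials_coverIdeal_iff {a : V →₀ ℕ} :
    a ∈ minimalMonomials (coverIdeal K G) ↔
      ∃ C : Finset V, Minimal G.IsVertexCover (C : Set V) ∧ a = ∑ x ∈ C, Finsupp.single x 1 := by
  classical
  have hmem : ∀ C : Finset V, G.IsVertexCover (C : Set V) →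
      MvPolynomial.monomial (∑ x ∈ C, Finsupp.single x 1) (1 : K) ∈ coverIdeal K G := by
    intro C hC
    rw [← prod_X_eq_monomial]
    exact prod_X_mem_coverIdeal hC
  constructor
  · intro ha
    obtain ⟨C, hCa, hC⟩ := exists_minimal_cover_subset (isVertexCover_of_monomial_mem ha.1)
    have hle : ∑ x ∈ C, Finsupp.single x 1 ≤ a := by
      intro y
      rw [sum_single_apply]
      split_ifs with h
      · exact Nat.one_le_iff_ne_zero.2 (Finsupp.mem_support_iff.1 (Finset.mem_coe.1 (hCa h)))
      · exact Nat.zero_le _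
    exact ⟨C, hC, le_antisymm (ha.2 (hmem C hC.1) hle) hle⟩
  · rintro ⟨C, hC, rfl⟩
    refine ⟨hmem C hC.1, fun b hb hle y => ?_⟩
    have hsub : (b.support : Set V) ⊆ C := by
      intro y hy
      have := hle y
      rw [sum_single_apply] at this
      by_contra hyC
      rw [if_neg (fun h => hyC (Finset.mem_coe.2 h))] at this
      exact Finsupp.mem_support_iff.1 (Finset.mem_coe.1 hy) (Nat.le_zero.1 this)
    rw [sum_single_apply]
    split_ifs with h
    · have := hC.2 (isVertexCover_of_monomial_mem hb) hsub (Finset.mem_coe.2 h)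
      exact Nat.one_le_iff_ne_zero.2 (Finsupp.mem_support_iff.1 (Finset.mem_coe.1 this))
    · exact Nat.zero_le _

theorem isGreatest_monomialDegree_coverIdeal (K : Type v) [Field K] (G : SimpleGraph V) :
    IsGreatest {n | ∃ C : Finset V, Minimal G.IsVertexCover (C : Set V) ∧ C.card = n}
      (monomialDegree (coverIdeal K G)) := by
  classical
  have e : (fun a : V →₀ ℕ => a.degree) '' minimalMonomials (coverIdeal K G) =
      {n | ∃ C : Finset V, Minimal G.IsVertexCover (C : Set V) ∧ C.card = n} := by
    ext n
    constructor
    · rintro ⟨a, ha, rfl⟩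
      obtain ⟨C, hC, rfl⟩ := mem_minimalMonomials_coverIdeal_iff.1 ha
      exact ⟨C, hC, (degree_sum_single C).symm⟩
    · rintro ⟨C, hC, rfl⟩
      exact ⟨_, mem_minimalMonomials_coverIdeal_iff.2 ⟨C, hC, rfl⟩, degree_sum_single C⟩
  have hb : BddAbove {n | ∃ C : Finset V, Minimal G.IsVertexCover (C : Set V) ∧ C.card = n} :=
    ⟨Fintype.card V, by rintro _ ⟨C, -, rfl⟩; exact C.card_le_univ⟩
  have hne : {n | ∃ C : Finset V, Minimal G.IsVertexCover (C : Set V) ∧ C.card = n}.Nonempty := by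
    obtain ⟨C, -, hC⟩ := exists_minimal_cover_subset
      (show G.IsVertexCover Set.univ from fun _ _ _ => Or.inl trivial)
    exact ⟨_, C, hC, rfl⟩
  rw [monomialDegree, e]
  exact ⟨Nat.sSup_mem hne hb, fun n hn => le_csSup hb hn⟩

/-- By minimality each `y ∈ C` has a neighbor `z ∉ C`. A divisor in the ideal has exponent `0` at
`z`, hence at least `k` at `y`. -/
theorem nsmul_mem_minimalMonomials {k : ℕ} {C : Finset V}
    (hC : Minimal G.IsVertexCover (C : Set V)) :
    k • ∑ x ∈ C, Finsupp.single x 1 ∈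
      minimalMonomials (monoIdeal K (coverSet G k Finset.univ 0)) := by
  classical
  have hval : ∀ y, (k • ∑ x ∈ C, Finsupp.single x 1 : V →₀ ℕ) y = if y ∈ C then k else 0 := by
    intro y
    rw [Finsupp.smul_apply, sum_single_apply]
    simp
  refine ⟨monomial_mem_monoIdeal.2 ⟨fun _ => Nat.zero_le _, fun i _ j _ hij => ?_⟩,
    fun b hb hle y => ?_⟩
  · rw [hval, hval]
    rcases hC.1 hij with h | h
    · rw [if_pos (Finset.mem_coe.1 h)]; omega
    · rw [if_pos (Finset.mem_coe.1 h)]; omega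
  · rw [hval]
    split_ifs with hy
    · obtain ⟨z, hyz, hzC⟩ : ∃ z, G.Adj y z ∧ z ∉ C := by
        by_contra! h
        have hcov : G.IsVertexCover ((C.erase y : Finset V) : Set V) := by
          intro i j hij
          rw [Finset.mem_coe, Finset.mem_coe, Finset.mem_erase, Finset.mem_erase]
          by_cases hi : i = y
          · subst hi
            exact Or.inr ⟨hij.ne', h j hij⟩
          · by_cases hj : j = y
            · subst hj
              exact Or.inl ⟨hi, h i hij.symm⟩
            · exact (hC.1 hij).imp (fun h => ⟨hi, h⟩) fun h => ⟨hj, h⟩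
        have := hC.2 hcov (Finset.coe_subset.2 (Finset.erase_subset _ _)) (Finset.mem_coe.2 hy)
        exact (Finset.mem_erase.1 (Finset.mem_coe.1 this)).1 rfl
      have h1 := hle z
      rw [hval, if_neg hzC] at h1
      have h2 := (monomial_mem_monoIdeal.1 hb).2 y (Finset.mem_univ _) z (Finset.mem_univ _) hyz
      omega
    · exact Nat.zero_le _

/-- The game starts at level `0` on the non-isolated vertices, with `t = k`; isolated ones impose no
condition and would spoil the half bound. -/
theorem ClawFree.regLE_coverSet_univ [Nonempty V] (hG : ClawFree G) (k : ℕ) {c : ℕ}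
    (hc : ∀ C : Finset V, Minimal G.IsVertexCover (C : Set V) → C.card ≤ c) :
    RegLE K (coverSet G k Finset.univ 0) (((k - 1) * c + Fintype.card V - 1 : ℕ) : ℤ) := by
  classical
  have hpos : 0 < Fintype.card V := Fintype.card_pos
  let W : Finset V := Finset.univ.filter fun x => ∃ y, G.Adj x y
  have hW : ∀ x, x ∈ W ↔ ∃ y, G.Adj x y := fun x => by simp [W]
  rw [coverSet_congr (Finset.subset_univ W) (fun i _ j _ hij hi => absurd ((hW i).2 ⟨j, hij⟩) hi)]
  refine hG.regLE_coverSet k k 0 (by omega) W 0 c _ (fun _ _ => rfl) ?_ ?_ (by simp) ?_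
  · intro x hx
    obtain ⟨y, hxy⟩ := (hW x).1 hx
    exact ⟨y, (hW y).2 ⟨x, hxy.symm⟩, hxy⟩
  · intro A hA hind
    -- Complements in `W` of independent dominating sets are minimal vertex covers of `G`, so `c`
    -- bounds their sizes.
    have hcov : Minimal G.IsVertexCover ((W \ A : Finset V) : Set V) := by
      refine ⟨fun i j hij => ?_, fun C hC hle x hx => ?_⟩
      · have hi := (hW i).2 ⟨j, hij⟩
        have hj := (hW j).2 ⟨i, hij.symm⟩
        rw [Finset.mem_coe, Finset.mem_coe, Finset.mem_sdiff, Finset.mem_sdiff]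
        by_cases hiA : i ∈ A
        · exact Or.inr ⟨hj, fun hjA => hind i hiA j hjA hij⟩
        · exact Or.inl ⟨hi, hiA⟩
      · rw [Finset.mem_coe, Finset.mem_sdiff] at hx
        obtain ⟨y, hyA, hxy⟩ := hA.2 x hx.1 hx.2
        refine (hC hxy).resolve_right fun hy => ?_
        exact (Finset.mem_sdiff.1 (Finset.mem_coe.1 (hle hy))).2 hyA
    have := hc _ hcov
    rw [Finset.card_sdiff_of_subset hA.1] at this
    omega
  · intro _ _
    have : W.card ≤ Fintype.card V := W.card_le_univ
    simp only [Pi.zero_apply, Finset.sum_const_zero]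
    omega

end Symbolic

end CoverIdealReg

theorem theorem3p7 {V : Type*} [Fintype V] [Nonempty V] (K : Type*) [Field K]
    (G : SimpleGraph V) (hG : CoverIdealReg.ClawFree G) (k : ℕ) (hk : 1 ≤ k) :
    ∃ r : ℤ,
      CoverIdealReg.HasRegularity
        (CoverIdealReg.symbolicPower (CoverIdealReg.coverIdeal K G) k) r ∧
      (k : ℤ) * (CoverIdealReg.monomialDegree (CoverIdealReg.coverIdeal K G) : ℤ) ≤ r ∧
      r ≤ ((k : ℤ) - 1) * (CoverIdealReg.monomialDegree (CoverIdealReg.coverIdeal K G) : ℤ)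
        + (Fintype.card V : ℤ) - 1 := by
  obtain ⟨⟨C, hC, hCc⟩, hmax⟩ := CoverIdealReg.isGreatest_monomialDegree_coverIdeal K G
  have hreg := hG.regLE_coverSet_univ (K := K) k fun D hD => hmax ⟨D, hD, rfl⟩
  obtain ⟨r, hr, hle, hge⟩ := CoverIdealReg.exists_hasRegularity
    CoverIdealReg.monomial_mem_of_mem_monoIdeal hreg
    (CoverIdealReg.nsmul_mem_minimalMonomials (k := k) hC)
  refine ⟨r, by rwa [CoverIdealReg.symbolicPower_coverIdeal], ?_, hge.trans (le_of_eq ?_)⟩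
  · rw [map_nsmul, CoverIdealReg.degree_sum_single, hCc] at hle
    exact_mod_cast hle
  · have hpos : 0 < Fintype.card V := Fintype.card_pos
    rw [Nat.cast_sub (by omega)]
    push_cast [Nat.cast_sub hk]
    ring
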